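/- Let $k$ be a field of characteristic zero. Let $\mathcal H_{CK}$ be the Connes–Kreimer Hopf algebra: the free commutative $k$-algebra on the non-empty (non-planar) rooted trees, with basis the rooted forests, graded by the number of vertices, with coproduct given on a tree by $$\Delta_{CK}(t)=t\otimes 1+\sum_{c}P^c(t)\otimes R^c(t),$$ where $c$ runs over the admissible cuts of $t$ (sets of edges, possibly empty, meeting every path from the root to a leaf at most once), $P^c(t)$ is the forest above the cut and $R^c(t)$ the tree under it. Let $\mathcal H$ be the free commutative $k$-algebra on the rooted trees with at least one edge, graded by the number of edges, whose unit is identified with the one-vertex tree $\bullet$, and whose counit $\epsilon$ vanishes on all trees with at least one edge. Let $\Phi:\mathcal H_{CK}\to\mathcal H\otimes\mathcal H_{CK}$ be the algebra morphism given on every non-empty tree $t$ by $$\Phi(t)=\sum_{s\subseteq t}s\otimes t/s,$$ where $s$ runs over the subforests of $t$ (families of pairwise disjoint subtrees with at least one edge each, including the empty family, which stands for the unit $\bullet$ of $\mathcal H$), and $t/s$ is obtained from $t$ by contracting each component of $s$ to a vertex. A character of $\mathcal H$ is a unital algebra morphism $\varphi:\mathcal H\to k$; an infinitesimal character is a linear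 map $a:\mathcal H\to k$ with $a(xy)=a(x)\epsilon(y)+\epsilon(x)a(y)$. For a linear map $a:\mathcal H\to k$ put ${}^tL_a=(a\otimes\mathrm{Id})\circ\Phi:\mathcal H_{CK}\to\mathcal H_{CK}$, and $L_a(b)=(a\otimes b)\circ\Phi$ for $b$ in the linear dual $\mathcal H_{CK}^*$. Let $\mathcal H_{CK}^\circ\subset\mathcal H_{CK}^*$ and $\mathcal H^\circ\subset\mathcal H^*$ be the graded duals (linear forms that vanish in all large degrees). Regard $\mathcal H_{CK}^*$, the completion of $\mathcal H_{CK}^\circ$, as a complete Hopf algebra: its product is the convolution product, its unit the counit of $\mathcal H_{CK}$, its counit the evaluation at $1$, and its coproduct, with values in the completed tensor square $(\mathcal H_{CK}\otimes\mathcal H_{CK})^*$, and antipode are the transposes of the product and the antipode of $\mathcal H_{CK}$. 1. For every infinitesimal character $a$ of $\mathcal H$, the operator ${}^tL_a$ is a biderivation of $\mathcal H_{CK}$, i.e. ${}^tL_a(xy)={}^tL_a(x)\,y+x\,{}^tL_a(y)$ and $\Delta_{CK}\circ{}^tL_a=({}^tL_a\otimes\mathrm{Id}+\mathrm{Id}\otimes{}^tL_a)\circ\Delta_{CK}$.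 2. For every character $\varphi$ of $\mathcal H$, the operator ${}^tL_\varphi$ is an automorphism of the Hopf algebra $\mathcal H_{CK}$. 3. For every infinitesimal character $a$ of $\mathcal H$, the operator $L_a$ is the transpose of ${}^tL_a$ and is a biderivation of the complete Hopf algebra $\mathcal H_{CK}^*$. If moreover $a\in\mathcal H^\circ$, then $L_a$ maps $\mathcal H_{CK}^\circ$ to itself and is a biderivation of the Hopf algebra $\mathcal H_{CK}^\circ$. 4. For every character $\varphi$ of $\mathcal H$, the operator $L_\varphi$ is the transpose of ${}^tL_\varphi$ and is an automorphism of the complete Hopf algebra $\mathcal H_{CK}^*$. -/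

import Mathlib

open scoped TensorProduct

namespace ForestHopf

/-! ### Rooted trees and forests -/

/-- Planar rooted forests: `cons c r` is the forest whose first tree has a root with the forest `c`
of branches above it, i.e. the tree `B₊(c)`, followed by the forest `r` of the other trees.
A planar rooted tree `B₊(c)` is encoded by the forest `c` of the branches of its root. -/
inductive PForest : Type
  | nil : PForest
  | cons (branches rest : PForest) : PForest

namespace PForest

/-- Juxtaposition of forests. -/
def append : PForest → PForest → PForest
  | nil, g => g
  | cons c r, g => cons c (append r g)

/-- Number of vertices of a forest. It is the number of edges of the tree `B₊(f)`. -/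
def size : PForest → ℕ
  | nil => 0
  | cons c r => c.size + 1 + r.size

/-- Elementary changes of the planar order: exchange two neighbouring trees of the forest, or two
neighbouring branches at any vertex. Two planar forests have the same underlying (non-planar)
rooted forest if and only if a chain of such moves connects them. -/
inductive Move : PForest → PForest → Prop
  | swap (c d r : PForest) : Move (cons c (cons d r)) (cons d (cons c r))
  | branches {c c' : PForest} (r : PForest) : Move c c' → Move (cons c r) (cons c' r)
  | rest (c : PForest) {r r' : PForest} : Move r r' → Move (cons c r) (cons c r')

end PForest

/-- Non-empty (non-planar) rooted trees: `RTree.mk c` is the tree `B₊(c)`. -/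
def RTree : Type := Quot PForest.Move

/-- The tree `B₊(c)`. -/
def RTree.mk (c : PForest) : RTree := Quot.mk _ c

/-- The tree with one vertex. -/
def RTree.bullet : RTree := RTree.mk PForest.nil

lemma PForest.Move.size_eq {c d : PForest} (h : PForest.Move c d) : c.size = d.size := by
  induction h with
  | swap => simp only [PForest.size]; omega
  | branches _ _ ih => simp only [PForest.size, ih]
  | rest _ _ ih => simp only [PForest.size, ih]

/-- Number of edges of a rooted tree. -/
def RTree.edges : RTree → ℕ := Quot.lift PForest.size fun _ _ h => h.size_eq

/-- Number of vertices of a rooted tree. -/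
def RTree.vertices (t : RTree) : ℕ := t.edges + 1

/-! ### Sets of edges of a rooted tree -/

/-- A planar rooted tree together with a set of edges, the marked ones. The tree is given by the
forest of branches of its root; the label of a branch tells whether the edge from the root to that
branch is marked. -/
inductive MForest : Type
  | nil : MForest
  | cons (mark : Bool) (branches rest : MForest) : MForest

/-- All sets of edges of the tree `B₊(c)`, each of them listed once. -/
def PForest.markings : PForest → List MForest
  | .nil => [.nil]
  | .cons c r => (([true, false] : List Bool) ×ˢ (c.markings ×ˢ r.markings)).map
      fun p => .cons p.1 p.2.1 p.2.2

namespace MForest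

/-- The underlying tree. -/
def erase : MForest → PForest
  | nil => .nil
  | cons _ c r => .cons c.erase r.erase

/-- Branches of the connected component of the root in the graph formed by the marked edges. -/
def rootComponent : MForest → PForest
  | nil => .nil
  | cons true c r => .cons c.rootComponent r.rootComponent
  | cons false _ r => r.rootComponent

/-- The connected components of the graph formed by all the vertices and the marked edges, without
the component of the root. -/
def otherComponents : MForest → PForest
  | nil => .nil
  | cons true c r => c.otherComponents.append r.otherComponents
  | cons false c r => .cons c.rootComponent (c.otherComponents.append r.otherComponents)

/-- All connected components of the graph formed by all the vertices and the marked edges. -/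
def components (m : MForest) : PForest := .cons m.rootComponent m.otherComponents

/-- Branches of the tree obtained by contracting every marked edge. -/
def contract : MForest → PForest
  | nil => .nil
  | cons true c r => c.contract.append r.contract
  | cons false c r => .cons c.contract r.contract

/-- No edge is marked. -/
def unmarked : MForest → Bool
  | nil => true
  | cons b c r => !b && c.unmarked && r.unmarked

/-- Admissible cuts: every path from the root to a leaf contains at most one marked edge. -/
def admissible : MForest → Bool
  | nil => true
  | cons true c r => c.unmarked && r.admissible
  | cons false c r => c.admissible && r.admissible

/-- The pruning of an admissible cut: the trees above the marked edges. -/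
def pruning : MForest → PForest
  | nil => .nil
  | cons true c r => .cons c.erase r.pruning
  | cons false c r => c.pruning.append r.pruning

/-- The trunk of an admissible cut, i.e. the tree under the marked edges, given by its branches. -/
def trunk : MForest → PForest
  | nil => .nil
  | cons true _ r => r.trunk
  | cons false c r => .cons c.trunk r.trunk

end MForest

/-- The admissible cuts of the tree `B₊(c)` (the total cut is not among them). -/
def PForest.cuts (c : PForest) : List MForest := c.markings.filter MForest.admissible

noncomputable section

universe u

variable (k : Type u) [CommRing k]

/-! ### The two algebras -/

/-- The Connes–Kreimer algebra: the free commutative algebra on the non-empty rooted trees. Its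
basis of monomials is formed by the rooted forests. -/
def HCK : Type u := MvPolynomial RTree k

instance : CommRing (HCK k) := inferInstanceAs (CommRing (MvPolynomial RTree k))
instance : Algebra k (HCK k) := inferInstanceAs (Algebra k (MvPolynomial RTree k))

/-- The algebra `𝓗 = S(T')`: the free commutative algebra on the rooted trees with at least one
edge. -/
def HCon : Type u := MvPolynomial {t : RTree // t ≠ RTree.bullet} k

instance : CommRing (HCon k) :=
  inferInstanceAs (CommRing (MvPolynomial {t : RTree // t ≠ RTree.bullet} k))
instance : Algebra k (HCon k) :=
  inferInstanceAs (Algebra k (MvPolynomial {t : RTree // t ≠ RTree.bullet} k))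

namespace HCK

variable {k}

/-- A tree as a generator of the Connes–Kreimer algebra. -/
def tree (t : RTree) : HCK k := MvPolynomial.X (R := k) t

/-- A forest as an element of the Connes–Kreimer algebra. -/
def forest : PForest → HCK k
  | .nil => 1
  | .cons c r => tree (RTree.mk c) * forest r

/-- The algebra morphism with given values on trees. -/
def lift {A : Type*} [CommRing A] [Algebra k A] (g : RTree → A) : HCK k →ₐ[k] A :=
  MvPolynomial.aeval (R := k) g

@[simp] lemma lift_tree {A : Type*} [CommRing A] [Algebra k A] (g : RTree → A) (t : RTree) :
    lift (k := k) g (tree t) = g t := MvPolynomial.aeval_X _ _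

lemma algHom_ext {A : Type*} [Semiring A] [Algebra k A] {g h : HCK k →ₐ[k] A}
    (H : ∀ t, g (tree t) = h (tree t)) : g = h :=
  MvPolynomial.algHom_ext (R := k) H

lemma forest_append (c d : PForest) :
    (forest (c.append d) : HCK k) = forest c * forest d := by
  induction c with
  | nil => simp [forest, PForest.append]
  | cons c r _ ih => simp [forest, PForest.append, ih, mul_assoc]

end HCK

namespace HCon

variable {k}

open Classical in
/-- A tree as an element of `𝓗`; the one-vertex tree is the unit of `𝓗`. -/
def tree (t : RTree) : HCon k :=
  if h : t = RTree.bullet then 1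
  else MvPolynomial.X (R := k) (⟨t, h⟩ : {t : RTree // t ≠ RTree.bullet})

/-- A forest as an element of `𝓗`, the one-vertex components being discarded. -/
def forest : PForest → HCon k
  | .nil => 1
  | .cons c r => tree (RTree.mk c) * forest r

/-- The counit of `𝓗`: it vanishes on the trees with at least one edge. -/
def counit : HCon k →ₐ[k] k :=
  MvPolynomial.aeval (R := k) fun _ : {t : RTree // t ≠ RTree.bullet} => (0 : k)

lemma forest_append (c d : PForest) :
    (forest (c.append d) : HCon k) = forest c * forest d := by
  induction c with
  | nil => simp [forest, PForest.append]
  | cons c r _ ih => simp [forest, PForest.append, ih, mul_assoc]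

end HCon

/-! ### The operator `B₊` -/

namespace PForest

/-- The planar forest with a given list of trees. -/
def ofList : List PForest → PForest
  | [] => nil
  | c :: l => cons c (ofList l)

/-- The list of trees of a planar forest. -/
def toList : PForest → List PForest
  | nil => []
  | cons c r => c :: r.toList

lemma ofList_toList (f : PForest) : ofList f.toList = f := by
  induction f with
  | nil => rfl
  | cons c r _ ih => simp [toList, ofList, ih]

end PForest

lemma RTree.mk_eq {c d : PForest} (h : PForest.Move c d) : RTree.mk c = RTree.mk d := Quot.sound h

lemma RTree.mk_cons_rest (c : PForest) {r r' : PForest} (h : RTree.mk r = RTree.mk r') :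
    RTree.mk (.cons c r) = RTree.mk (.cons c r') :=
  congrArg (Quot.map (PForest.cons c) fun _ _ => PForest.Move.rest c) h

lemma RTree.mk_cons_branches {c c' : PForest} (r : PForest) (h : RTree.mk c = RTree.mk c') :
    RTree.mk (.cons c r) = RTree.mk (.cons c' r) :=
  congrArg (Quot.map (fun c => PForest.cons c r) fun _ _ => PForest.Move.branches r) h

lemma RTree.mk_ofList_perm {l l' : List PForest} (h : l.Perm l') :
    RTree.mk (.ofList l) = RTree.mk (.ofList l') := by
  induction h with
  | nil => rfl
  | cons c _ ih => exact RTree.mk_cons_rest c ih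
  | swap c d l => exact RTree.mk_eq (.swap _ _ _)
  | trans _ _ ih ih' => exact ih.trans ih'

/-- The tree with given branches at its root. -/
def RTree.graft (s : Multiset RTree) : RTree :=
  Quotient.liftOn s (fun l => RTree.mk (.ofList (l.map Quot.out)))
    fun _ _ h => RTree.mk_ofList_perm (h.map _)

lemma RTree.mk_out (t : RTree) : RTree.mk (Quot.out t) = t := Quot.out_eq t

lemma RTree.graft_coe (c : PForest) :
    RTree.graft (c.toList.map RTree.mk : List RTree) = RTree.mk c := by
  change RTree.mk (.ofList ((c.toList.map RTree.mk).map Quot.out)) = _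
  induction c with
  | nil => rfl
  | cons c r _ ih =>
    exact (RTree.mk_cons_rest _ ih).trans (RTree.mk_cons_branches _ (RTree.mk_out _))

/-- The operator `B₊`, which grafts the trees of a forest on a common new root. -/
def bPlus : HCK k →ₗ[k] HCK k :=
  (MvPolynomial.basisMonomials RTree k).constr k
    fun s => HCK.tree (RTree.graft (Finsupp.toMultiset s))

variable {k}

open Classical in
lemma HCK.forest_eq (c : PForest) : (HCK.forest c : HCK k) =
    MvPolynomial.monomial (Multiset.toFinsupp (c.toList.map RTree.mk : List RTree)) (1 : k) := by
  induction c with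
  | nil => rfl
  | cons c r _ ih =>
    rw [HCK.forest, ih, HCK.tree, MvPolynomial.X]
    refine (MvPolynomial.monomial_mul (R := k)).trans ?_
    rw [PForest.toList, List.map_cons, ← Multiset.cons_coe, ← Multiset.singleton_add, map_add,
      Multiset.toFinsupp_singleton, one_mul]

lemma bPlus_forest (c : PForest) : bPlus k (HCK.forest c) = HCK.tree (RTree.mk c) := by
  classical
  rw [HCK.forest_eq, bPlus]
  have := (MvPolynomial.basisMonomials RTree k).constr_basis k
    (fun s => (HCK.tree (RTree.graft (Finsupp.toMultiset s)) : HCK k))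
    (Multiset.toFinsupp (c.toList.map RTree.mk : List RTree))
  rw [MvPolynomial.coe_basisMonomials] at this
  refine this.trans ?_
  rw [Multiset.toFinsupp_toMultiset, RTree.graft_coe]

lemma HCK.exists_forest (s : RTree →₀ ℕ) :
    ∃ c : PForest, (HCK.forest c : HCK k) = MvPolynomial.monomial s (1 : k) := by
  classical
  refine ⟨.ofList ((Finsupp.toMultiset s).toList.map Quot.out), ?_⟩
  have h : ∀ l : List RTree, (PForest.ofList (l.map Quot.out)).toList.map RTree.mk = l := by
    intro l
    induction l with
    | nil => rfl
    | cons a l ih => exact congrArg₂ List.cons (RTree.mk_out a) ih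
  rw [HCK.forest_eq, h, Multiset.coe_toList, Finsupp.toMultiset_toFinsupp]

lemma HCK.linearMap_ext {M : Type*} [AddCommMonoid M] [Module k M] {g h : HCK k →ₗ[k] M}
    (H : ∀ c, g (HCK.forest c) = h (HCK.forest c)) : g = h := by
  refine (MvPolynomial.basisMonomials RTree k).ext (M₁ := M) fun s => ?_
  obtain ⟨c, hc⟩ := HCK.exists_forest (k := k) s
  rw [MvPolynomial.coe_basisMonomials]
  have := H c
  rw [hc] at this
  exact this

/-! ### The Connes–Kreimer coproduct -/

lemma sum_filter_map {α M : Type*} [AddCommMonoid M] (p : α → Bool) (F : α → M) (l : List α) :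
    ((l.filter p).map F).sum = (l.map fun x => if p x then F x else 0).sum := by
  induction l with
  | nil => rfl
  | cons a l ih => by_cases h : p a <;> simp [h, ih]

lemma sum_markings_cons {M : Type*} [AddCommMonoid M] (c r : PForest) (F : MForest → M) :
    ((PForest.cons c r).markings.map F).sum =
      (c.markings.map fun m => (r.markings.map fun n => F (.cons true m n)).sum).sum +
      (c.markings.map fun m => (r.markings.map fun n => F (.cons false m n)).sum).sum := by
  have key : ∀ (b : Bool) (l l' : List MForest),
      (((l ×ˢ l').map (Prod.mk b)).map fun p => F (.cons p.1 p.2.1 p.2.2)).sum =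
        (l.map fun m => (l'.map fun n => F (.cons b m n)).sum).sum := by
    intro b l l'
    induction l with
    | nil => rfl
    | cons a l ih => simpa [Function.comp_def] using congrArg (_ + ·) ih
  have h : ((([true, false] : List Bool) ×ˢ (c.markings ×ˢ r.markings)) :
      List (Bool × MForest × MForest)) =
      (c.markings ×ˢ r.markings).map (Prod.mk true) ++
        (c.markings ×ˢ r.markings).map (Prod.mk false) := by
    simp
  rw [PForest.markings, List.map_map, h, List.map_append, List.sum_append]
  exact congrArg₂ (· + ·) (key _ _ _) (key _ _ _)

lemma erase_of_mem_markings (c : PForest) : ∀ m ∈ c.markings, m.erase = c := by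
  induction c with
  | nil => simp [PForest.markings, MForest.erase]
  | cons c r ihc ihr =>
    intro m hm
    simp only [PForest.markings, List.mem_map] at hm
    obtain ⟨⟨b, m, n⟩, h, rfl⟩ := hm
    obtain ⟨-, h⟩ := List.pair_mem_product.1 h
    obtain ⟨h1, h2⟩ := List.pair_mem_product.1 h
    rw [MForest.erase, ihc _ h1, ihr _ h2]

lemma sum_mul_sum {A : Type*} [CommRing A] (l l' : List MForest) (F G : MForest → A) :
    (l.map fun m => (l'.map fun n => F m * G n).sum).sum = (l.map F).sum * (l'.map G).sum := by
  simp [List.sum_map_mul_left, List.sum_map_mul_right]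

lemma sum_unmarked {A : Type*} [CommRing A] (c : PForest) :
    (c.markings.map fun m => if m.unmarked then (1 : A) else 0).sum = 1 := by
  induction c with
  | nil => simp [PForest.markings, MForest.unmarked]
  | cons c r ihc ihr =>
    rw [sum_markings_cons]
    have h (m n : MForest) : (if (MForest.cons false m n).unmarked then (1 : A) else 0) =
        (if m.unmarked then (1 : A) else 0) * (if n.unmarked then (1 : A) else 0) := by
      cases hm : m.unmarked <;> cases hn : n.unmarked <;> simp [MForest.unmarked, hm, hn]
    simp only [h, sum_mul_sum, ihc, ihr]
    simp [MForest.unmarked]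

variable (k) in
/-- The coproduct of the tree `B₊(c)`: the sum, over the total cut and all admissible cuts, of
the pruning tensor the trunk. -/
def coprodTree (c : PForest) : HCK k ⊗[k] HCK k :=
  HCK.tree (RTree.mk c) ⊗ₜ[k] 1 +
    (c.cuts.map fun m => HCK.forest m.pruning ⊗ₜ[k] HCK.tree (RTree.mk m.trunk)).sum

variable (k) in
/-- Auxiliary sum: the coproduct of the forest `c`. -/
def coprodForest (c : PForest) : HCK k ⊗[k] HCK k :=
  (c.cuts.map fun m => HCK.forest m.pruning ⊗ₜ[k] HCK.forest m.trunk).sum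

lemma coprodTree_eq (c : PForest) : coprodTree k c = HCK.tree (RTree.mk c) ⊗ₜ[k] 1 +
    (bPlus k).lTensor (HCK k) (coprodForest k c) := by
  rw [coprodTree, coprodForest, map_list_sum, List.map_map]
  simp [Function.comp_def, bPlus_forest]

lemma coprodForest_nil : coprodForest k .nil = 1 := by
  simp only [coprodForest, PForest.cuts, PForest.markings, sum_filter_map]
  simp [MForest.admissible, MForest.pruning, MForest.trunk, HCK.forest,
    Algebra.TensorProduct.one_def]

lemma coprodForest_cons (c r : PForest) :
    coprodForest k (.cons c r) = coprodTree k c * coprodForest k r := by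
  rw [coprodTree, add_mul, coprodForest, coprodForest, PForest.cuts, PForest.cuts, PForest.cuts,
    sum_filter_map, sum_filter_map, sum_filter_map, sum_markings_cons, ← sum_mul_sum]
  congr 1
  · have h : ∀ m ∈ c.markings, ∀ n,
        (if (MForest.cons true m n).admissible then HCK.forest (MForest.cons true m n).pruning ⊗ₜ[k]
          HCK.forest (MForest.cons true m n).trunk else (0 : HCK k ⊗[k] HCK k)) =
        (if m.unmarked then (1 : HCK k ⊗[k] HCK k) else 0) *
        ((HCK.tree (RTree.mk c) ⊗ₜ[k] 1) * if n.admissible then HCK.forest n.pruning ⊗ₜ[k]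
          HCK.forest n.trunk else (0 : HCK k ⊗[k] HCK k)) := by
      intro m hm n
      cases h1 : m.unmarked <;> cases h2 : n.admissible <;>
        simp [MForest.admissible, h1, h2, MForest.pruning, MForest.trunk, HCK.forest,
          erase_of_mem_markings c m hm]
    rw [List.map_congr_left fun m hm => congrArg List.sum (List.map_congr_left fun n _ => h m hm n),
      sum_mul_sum, sum_unmarked, one_mul, List.sum_map_mul_left]
  · have h (m n : MForest) :
        (if (MForest.cons false m n).admissible then
          HCK.forest (MForest.cons false m n).pruning ⊗ₜ[k]
          HCK.forest (MForest.cons false m n).trunk else (0 : HCK k ⊗[k] HCK k)) =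
        (if m.admissible then HCK.forest m.pruning ⊗ₜ[k]
          HCK.tree (RTree.mk m.trunk) else (0 : HCK k ⊗[k] HCK k)) *
        if n.admissible then HCK.forest n.pruning ⊗ₜ[k]
          HCK.forest n.trunk else (0 : HCK k ⊗[k] HCK k) := by
      cases h1 : m.admissible <;> cases h2 : n.admissible <;>
        simp [MForest.admissible, h1, h2, MForest.pruning, MForest.trunk, HCK.forest,
          HCK.forest_append]
    simp only [h]

lemma coprodForest_move {c d : PForest} (h : PForest.Move c d) :
    coprodForest k c = coprodForest k d := by
  induction h with
  | swap c d r => simp only [coprodForest_cons]; ring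
  | branches r h ih =>
    rw [coprodForest_cons, coprodForest_cons, coprodTree_eq, coprodTree_eq, ih, RTree.mk_eq h]
  | rest c h ih => rw [coprodForest_cons, coprodForest_cons, ih]

lemma coprodTree_move {c d : PForest} (h : PForest.Move c d) :
    coprodTree k c = coprodTree k d := by
  rw [coprodTree_eq, coprodTree_eq, coprodForest_move h, RTree.mk_eq h]

namespace HCK

variable (k) in
/-- The Connes–Kreimer coproduct. -/
def comulHom : HCK k →ₐ[k] HCK k ⊗[k] HCK k :=
  lift (Quot.lift (coprodTree k) fun _ _ h => coprodTree_move h)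

variable (k) in
/-- The counit of the Connes–Kreimer algebra: it vanishes on all trees. -/
def counitHom : HCK k →ₐ[k] k := lift fun _ => 0

lemma comulHom_tree (c : PForest) : comulHom k (tree (RTree.mk c)) = coprodTree k c :=
  lift_tree _ _

lemma comulHom_forest (c : PForest) : comulHom k (forest c) = coprodForest k c := by
  induction c with
  | nil => rw [forest, map_one, coprodForest_nil]
  | cons c r _ ih => rw [forest, map_mul, comulHom_tree, ih, coprodForest_cons]

lemma comulHom_bPlus (x : HCK k) : comulHom k (bPlus k x) =
    bPlus k x ⊗ₜ[k] 1 + (bPlus k).lTensor (HCK k) (comulHom k x) := by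
  have : (comulHom k).toLinearMap ∘ₗ bPlus k = ((TensorProduct.mk k (HCK k) (HCK k)).flip 1) ∘ₗ
      bPlus k + (bPlus k).lTensor (HCK k) ∘ₗ (comulHom k).toLinearMap := by
    refine linearMap_ext fun c => ?_
    simp [bPlus_forest, comulHom_tree, comulHom_forest, coprodTree_eq]
  exact LinearMap.congr_fun this x

lemma counitHom_bPlus (x : HCK k) : counitHom k (bPlus k x) = 0 := by
  have : (counitHom k).toLinearMap ∘ₗ bPlus k = 0 := by
    refine linearMap_ext fun c => ?_
    simp [bPlus_forest, counitHom]
  exact LinearMap.congr_fun this x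

/-- Induction on the number of vertices: an identity of algebra morphisms can be checked on
`B₊(c)` once it is known on the forest `c`. -/
lemma algHom_ext_bPlus {A : Type*} [Semiring A] [Algebra k A] {g h : HCK k →ₐ[k] A}
    (H : ∀ x, g x = h x → g (bPlus k x) = h (bPlus k x)) : g = h := by
  have key : ∀ c : PForest, g (forest c) = h (forest c) := by
    intro c
    induction c with
    | nil => simp [forest]
    | cons c r ihc ihr => rw [forest, map_mul, map_mul, ihr, ← bPlus_forest, H _ ihc]
  refine algHom_ext fun t => ?_
  obtain ⟨c, rfl⟩ := Quot.exists_rep t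
  exact bPlus_forest (k := k) c ▸ H _ (key c)

open Algebra.TensorProduct in
lemma comulHom_coassoc :
    (Algebra.TensorProduct.assoc k k k (HCK k) (HCK k) (HCK k)).toAlgHom.comp
      ((map (comulHom k) (AlgHom.id k (HCK k))).comp (comulHom k)) =
    (map (AlgHom.id k (HCK k)) (comulHom k)).comp (comulHom k) := by
  refine algHom_ext_bPlus fun x hx => ?_
  have h1 : ∀ y : HCK k ⊗[k] HCK k,
      map (comulHom k) (AlgHom.id k (HCK k)) ((bPlus k).lTensor (HCK k) y) =
      (bPlus k).lTensor (HCK k ⊗[k] HCK k) (map (comulHom k) (AlgHom.id k (HCK k)) y) := by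
    intro y
    induction y with
    | zero => simp
    | add a b ha hb => simp only [map_add, ha, hb]
    | tmul a b => simp
  have h2 : ∀ y : (HCK k ⊗[k] HCK k) ⊗[k] HCK k,
      Algebra.TensorProduct.assoc k k k (HCK k) (HCK k) (HCK k)
        ((bPlus k).lTensor (HCK k ⊗[k] HCK k) y) =
      ((bPlus k).lTensor (HCK k)).lTensor (HCK k)
        (Algebra.TensorProduct.assoc k k k (HCK k) (HCK k) (HCK k) y) := by
    intro y
    induction y with
    | zero => simp
    | add a b ha hb => simp only [map_add, ha, hb]
    | tmul a b =>
      induction a with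
      | zero => simp
      | add a b ha hb => simp only [TensorProduct.add_tmul, map_add, ha, hb]
      | tmul a b => simp
  have h3 : ∀ y : HCK k ⊗[k] HCK k,
      map (AlgHom.id k (HCK k)) (comulHom k) ((bPlus k).lTensor (HCK k) y) =
      Algebra.TensorProduct.assoc k k k (HCK k) (HCK k) (HCK k)
        ((bPlus k).lTensor (HCK k) y ⊗ₜ[k] 1) +
      ((bPlus k).lTensor (HCK k)).lTensor (HCK k)
        (map (AlgHom.id k (HCK k)) (comulHom k) y) := by
    intro y
    induction y with
    | zero => simp
    | add a b ha hb =>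
      simp only [map_add, ha, hb, TensorProduct.add_tmul]
      abel
    | tmul a b => simp [comulHom_bPlus, TensorProduct.tmul_add]
  have hx' : Algebra.TensorProduct.assoc k k k (HCK k) (HCK k) (HCK k)
      (map (comulHom k) (AlgHom.id k (HCK k)) (comulHom k x)) =
      map (AlgHom.id k (HCK k)) (comulHom k) (comulHom k x) := hx
  change Algebra.TensorProduct.assoc k k k (HCK k) (HCK k) (HCK k)
      (map (comulHom k) (AlgHom.id k (HCK k)) (comulHom k (bPlus k x))) =
      map (AlgHom.id k (HCK k)) (comulHom k) (comulHom k (bPlus k x))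
  rw [comulHom_bPlus, map_add, map_add, map_add, h1, h2, h3, ← hx', map_tmul, map_tmul,
    comulHom_bPlus, TensorProduct.add_tmul, map_add]
  simp [one_def, add_assoc]

open Algebra.TensorProduct in
lemma rTensor_counitHom :
    (map (counitHom k) (AlgHom.id k (HCK k))).comp (comulHom k) =
      (Algebra.TensorProduct.lid k (HCK k)).symm.toAlgHom := by
  refine algHom_ext_bPlus fun x hx => ?_
  have h1 : ∀ y : HCK k ⊗[k] HCK k,
      map (counitHom k) (AlgHom.id k (HCK k)) ((bPlus k).lTensor (HCK k) y) =
      (bPlus k).lTensor k (map (counitHom k) (AlgHom.id k (HCK k)) y) := by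
    intro y
    induction y with
    | zero => simp
    | add a b ha hb => simp only [map_add, ha, hb]
    | tmul a b => simp
  have hx' : map (counitHom k) (AlgHom.id k (HCK k)) (comulHom k x) = 1 ⊗ₜ[k] x := hx
  change map (counitHom k) (AlgHom.id k (HCK k)) (comulHom k (bPlus k x)) = 1 ⊗ₜ[k] bPlus k x
  rw [comulHom_bPlus, map_add, h1, hx']
  simp [counitHom_bPlus]

open Algebra.TensorProduct in
lemma lTensor_counitHom :
    (map (AlgHom.id k (HCK k)) (counitHom k)).comp (comulHom k) =
      (Algebra.TensorProduct.rid k k (HCK k)).symm.toAlgHom := by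
  refine algHom_ext_bPlus fun x _ => ?_
  have h1 : ∀ y : HCK k ⊗[k] HCK k,
      map (AlgHom.id k (HCK k)) (counitHom k) ((bPlus k).lTensor (HCK k) y) = 0 := by
    intro y
    induction y with
    | zero => simp
    | add a b ha hb => simp only [map_add, ha, hb, add_zero]
    | tmul a b => simp [counitHom_bPlus]
  change map (AlgHom.id k (HCK k)) (counitHom k) (comulHom k (bPlus k x)) = bPlus k x ⊗ₜ[k] 1
  rw [comulHom_bPlus, map_add, h1]
  simp

instance : Bialgebra k (HCK k) :=
  Bialgebra.ofAlgHom (comulHom k) (counitHom k) comulHom_coassoc rTensor_counitHom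
    lTensor_counitHom

/-! ### The antipode -/

open WithConv

/-- The span of the `a ⊗ y` with `a` a forest with less than `n` vertices. -/
def lowSpan (n : ℕ) : Submodule k (HCK k ⊗[k] HCK k) :=
  Submodule.span k {z | ∃ (c : PForest) (y : HCK k), c.size < n ∧ z = forest c ⊗ₜ[k] y}

lemma tmul_mem_lowSpan {n : ℕ} (c : PForest) (y : HCK k) (h : c.size < n) :
    forest c ⊗ₜ[k] y ∈ lowSpan (k := k) n := Submodule.subset_span ⟨c, y, h, rfl⟩

lemma lowSpan_mono {n m : ℕ} (h : n ≤ m) : lowSpan (k := k) n ≤ lowSpan m :=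
  Submodule.span_mono fun _ ⟨c, y, hc, hz⟩ => ⟨c, y, hc.trans_le h, hz⟩

lemma size_append (c d : PForest) : (c.append d).size = c.size + d.size := by
  induction c with
  | nil => simp [PForest.append, PForest.size]
  | cons c r _ ih => simp only [PForest.append, PForest.size, ih]; omega

lemma mul_mem_lowSpan {n m : ℕ} {z w : HCK k ⊗[k] HCK k} (hz : z ∈ lowSpan n)
    (hw : w ∈ lowSpan (m + 1)) : z * w ∈ lowSpan (n + m) := by
  induction hz using Submodule.span_induction with
  | zero => simp
  | add a b _ _ ha hb => rw [add_mul]; exact add_mem ha hb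
  | smul r a _ ha => rw [smul_mul_assoc]; exact Submodule.smul_mem _ _ ha
  | mem z hz =>
    obtain ⟨c, y, hc, rfl⟩ := hz
    induction hw using Submodule.span_induction with
    | zero => simp
    | add a b _ _ ha hb => rw [mul_add]; exact add_mem ha hb
    | smul r a _ ha => rw [mul_smul_comm]; exact Submodule.smul_mem _ _ ha
    | mem w hw =>
      obtain ⟨d, y', hd, rfl⟩ := hw
      rw [Algebra.TensorProduct.tmul_mul_tmul, ← forest_append]
      exact tmul_mem_lowSpan _ _ (by rw [size_append]; omega)

lemma lTensor_mem_lowSpan {n : ℕ} {z : HCK k ⊗[k] HCK k} (hz : z ∈ lowSpan n) :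
    (bPlus k).lTensor (HCK k) z ∈ lowSpan n := by
  induction hz using Submodule.span_induction with
  | zero => simp
  | add a b _ _ ha hb => rw [map_add]; exact add_mem ha hb
  | smul r a _ ha => rw [map_smul]; exact Submodule.smul_mem _ _ ha
  | mem z hz =>
    obtain ⟨c, y, hc, rfl⟩ := hz
    exact tmul_mem_lowSpan _ _ hc

lemma comulHom_forest_sub (c : PForest) :
    comulHom k (forest c) - forest c ⊗ₜ[k] 1 ∈ lowSpan c.size := by
  induction c with
  | nil => simp [forest, Algebra.TensorProduct.one_def]
  | cons c r ihc ihr =>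
    have hc : comulHom k (forest c) ∈ lowSpan (k := k) (c.size + 1) := by
      rw [← sub_add_cancel (comulHom k (forest c)) (forest c ⊗ₜ[k] 1)]
      exact add_mem (lowSpan_mono (Nat.le_succ _) ihc)
        (tmul_mem_lowSpan _ _ (Nat.lt_succ_self _))
    set w := comulHom k (forest r) - forest r ⊗ₜ[k] 1 with hw
    have hr : comulHom k (forest r) = forest r ⊗ₜ[k] 1 + w := by rw [hw]; abel
    have ht : (tree (RTree.mk c) : HCK k) = forest (.cons c .nil) := by simp [forest]
    have e : comulHom k (forest (.cons c r)) - forest (.cons c r) ⊗ₜ[k] 1 =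
        w * (tree (RTree.mk c) ⊗ₜ[k] 1) +
        (bPlus k).lTensor (HCK k) (comulHom k (forest c)) * comulHom k (forest r) := by
      rw [forest, map_mul, ← bPlus_forest, comulHom_bPlus, add_mul, hr, mul_add,
        Algebra.TensorProduct.tmul_mul_tmul, mul_one, mul_comm w]
      abel
    rw [e, PForest.size]
    refine add_mem ?_ ?_
    · refine lowSpan_mono (le_of_eq ?_) (mul_mem_lowSpan ihr (m := c.size + 1) ?_)
      · omega
      · rw [ht]
        exact tmul_mem_lowSpan _ _ (by simp [PForest.size])
    · refine mul_mem_lowSpan (lTensor_mem_lowSpan hc) ?_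
      rw [hr]
      exact add_mem (tmul_mem_lowSpan _ _ (Nat.lt_succ_self _))
        (lowSpan_mono (Nat.le_succ _) ihr)

lemma comulHom_forest_mem (c : PForest) :
    comulHom k (forest c) ∈ lowSpan (k := k) (c.size + 1) := by
  rw [← sub_add_cancel (comulHom k (forest c)) (forest c ⊗ₜ[k] 1)]
  exact add_mem (lowSpan_mono (Nat.le_succ _) (comulHom_forest_sub c))
    (tmul_mem_lowSpan _ _ (Nat.lt_succ_self _))

lemma conv_apply (f g : WithConv (HCK k →ₗ[k] HCK k)) (x : HCK k) :
    (f * g).ofConv x =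
      LinearMap.mul' k (HCK k) (TensorProduct.map f.ofConv g.ofConv (comulHom k x)) := rfl

lemma map_eq_of_mem_lowSpan {n : ℕ} {f f' : HCK k →ₗ[k] HCK k} (g : HCK k →ₗ[k] HCK k)
    (h : ∀ c : PForest, c.size < n → f (forest c) = f' (forest c)) {z : HCK k ⊗[k] HCK k}
    (hz : z ∈ lowSpan n) : TensorProduct.map f g z = TensorProduct.map f' g z := by
  induction hz using Submodule.span_induction with
  | zero => simp
  | add a b _ _ ha hb => rw [map_add, map_add, ha, hb]
  | smul r a _ ha => rw [map_smul, map_smul, ha]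
  | mem z hz =>
    obtain ⟨c, y, hc, rfl⟩ := hz
    rw [TensorProduct.map_tmul, TensorProduct.map_tmul, h c hc]

/-- A linear map that vanishes on `1` is locally nilpotent for the convolution product. -/
lemma conv_pow_forest (J : WithConv (HCK k →ₗ[k] HCK k)) (hJ : J.ofConv 1 = 0) (n : ℕ) :
    ∀ c : PForest, c.size < n → (J ^ n).ofConv (forest c) = 0 := by
  induction n with
  | zero => intro c hc; omega
  | succ n ih =>
    intro c hc
    rw [pow_succ, conv_apply,
      ← sub_add_cancel (comulHom k (forest c)) (forest c ⊗ₜ[k] 1), map_add,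
      map_eq_of_mem_lowSpan (n := c.size) (f' := 0) _
        (fun d hd => ih d (by omega)) (comulHom_forest_sub c)]
    simp [hJ]

/-- The number of vertices of a monomial. -/
def weight (s : RTree →₀ ℕ) : ℕ := Finsupp.weight RTree.vertices s

open Classical in
lemma weight_forest (c : PForest) :
    weight (Multiset.toFinsupp (c.toList.map RTree.mk : List RTree)) = c.size := by
  induction c with
  | nil => rfl
  | cons c r _ ih =>
    rw [PForest.toList, List.map_cons, ← Multiset.cons_coe, ← Multiset.singleton_add, map_add,
      Multiset.toFinsupp_singleton, weight, map_add]
    rw [weight] at ih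
    rw [ih, Finsupp.weight_single, one_smul]
    rfl

lemma exists_conv_inverse (T : WithConv (HCK k →ₗ[k] HCK k)) (hT : T.ofConv 1 = 1) :
    ∃ S : WithConv (HCK k →ₗ[k] HCK k), S * T = 1 ∧ S.ofConv 1 = 1 := by
  classical
  set J := 1 - T with hJdef
  have hone : (1 : WithConv (HCK k →ₗ[k] HCK k)).ofConv 1 = 1 := by
    rw [LinearMap.convOne_def]
    change algebraMap k (HCK k) (counitHom k 1) = 1
    simp
  have hJ : J.ofConv 1 = 0 := by
    rw [hJdef, WithConv.ofConv_sub, LinearMap.sub_apply, hone, hT, sub_self]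
  let P : ℕ → WithConv (HCK k →ₗ[k] HCK k) := fun n => ∑ i ∈ Finset.range (n + 1), J ^ i
  let S : HCK k →ₗ[k] HCK k := (MvPolynomial.basisMonomials RTree k).constr k
    fun s => (P (weight s)).ofConv (MvPolynomial.monomial s (1 : k))
  have hS0 : ∀ c : PForest, S (forest c) = (P c.size).ofConv (forest c) := by
    intro c
    have := (MvPolynomial.basisMonomials RTree k).constr_basis k
      (fun s => (P (weight s)).ofConv (MvPolynomial.monomial s (1 : k)))
      (Multiset.toFinsupp (c.toList.map RTree.mk : List RTree))
    rw [MvPolynomial.coe_basisMonomials, weight_forest, ← forest_eq] at this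
    rw [← this, forest_eq]
    rfl
  have hP : ∀ n m (c : PForest), c.size ≤ n →
      (P (n + m)).ofConv (forest c) = (P n).ofConv (forest c) := by
    intro n m c hc
    induction m with
    | zero => rfl
    | succ m ih =>
      rw [← ih]
      change (∑ i ∈ Finset.range (n + m + 1 + 1), J ^ i).ofConv _ = _
      rw [Finset.sum_range_succ, WithConv.ofConv_add, LinearMap.add_apply,
        conv_pow_forest J hJ _ c (by omega), add_zero]
  have hS : ∀ n (c : PForest), c.size < n + 1 → S (forest c) = (P n).ofConv (forest c) := by
    intro n c hc
    obtain ⟨m, rfl⟩ := Nat.exists_eq_add_of_le (Nat.lt_succ_iff.1 hc)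
    rw [hS0, hP _ _ _ le_rfl]
  have hST : toConv S * T = 1 := by
    refine WithConv.ofConv_injective (linearMap_ext fun c => ?_)
    rw [conv_apply, map_eq_of_mem_lowSpan (n := c.size + 1) _ (hS c.size) (comulHom_forest_mem c),
      ← conv_apply]
    have : P c.size * T = 1 - J ^ (c.size + 1) := by
      have hT' : T = 1 - J := by rw [hJdef]; abel
      rw [hT']
      exact geom_sum_mul_neg J _
    rw [this, WithConv.ofConv_sub, LinearMap.sub_apply,
      conv_pow_forest J hJ _ c (Nat.lt_succ_self _), sub_zero]
  refine ⟨toConv S, hST, ?_⟩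
  have := LinearMap.congr_fun (congrArg WithConv.ofConv hST) (1 : HCK k)
  rw [conv_apply, hone, map_one] at this
  simpa [Algebra.TensorProduct.one_def, hT] using this

variable (k) in
lemma exists_antipode : ∃ S : WithConv (HCK k →ₗ[k] HCK k),
    S * toConv LinearMap.id = 1 ∧ toConv LinearMap.id * S = 1 := by
  obtain ⟨S, hS, hS1⟩ := exists_conv_inverse (k := k) (toConv LinearMap.id) rfl
  obtain ⟨S', hS', -⟩ := exists_conv_inverse S hS1
  have : S' = toConv LinearMap.id := left_inv_eq_right_inv hS' hS
  exact ⟨S, hS, this ▸ hS'⟩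

/-- The Connes–Kreimer Hopf algebra. -/
instance : HopfAlgebra k (HCK k) where
  antipode := (exists_antipode k).choose.ofConv
  mul_antipode_rTensor_comul :=
    congrArg WithConv.ofConv (exists_antipode k).choose_spec.1
  mul_antipode_lTensor_comul :=
    congrArg WithConv.ofConv (exists_antipode k).choose_spec.2

end HCK

/-! ### The coaction of `𝓗` on the Connes–Kreimer Hopf algebra -/

variable (k) in
/-- The value of the coaction on the tree `t = B₊(c)`: the sum of `s ⊗ t/s` over the subforests
`s` of `t`. A subforest, i.e. a family of disjoint subtrees with at least one edge each, is given
by its set of edges. -/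
def coactTree (c : PForest) : HCon k ⊗[k] HCK k :=
  (c.markings.map fun m => HCon.forest m.components ⊗ₜ[k] HCK.tree (RTree.mk m.contract)).sum

/-- The algebra morphism that identifies the one-vertex tree with the unit. -/
def toHCon : HCK k →ₐ[k] HCon k := HCK.lift HCon.tree

variable (k) in
/-- Auxiliary sum, which keeps track of the component of the root. -/
def coactAux (c : PForest) : HCK k ⊗[k] (HCon k ⊗[k] HCK k) :=
  (c.markings.map fun m => HCK.forest m.rootComponent ⊗ₜ[k]
    (HCon.forest m.otherComponents ⊗ₜ[k] HCK.forest m.contract)).sum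

variable (k) in
/-- Auxiliary map `x ⊗ h ⊗ y ↦ B₊(x) h ⊗ B₊(y)`. -/
def coactClose : HCK k ⊗[k] (HCon k ⊗[k] HCK k) →ₗ[k] HCon k ⊗[k] HCK k :=
  LinearMap.mul' k (HCon k ⊗[k] HCK k) ∘ₗ
    TensorProduct.map ((TensorProduct.mk k (HCon k) (HCK k)).flip 1 ∘ₗ toHCon.toLinearMap ∘ₗ
      bPlus k) ((bPlus k).lTensor (HCon k))

lemma coactTree_eq (c : PForest) : coactTree k c = coactClose k (coactAux k c) := by
  rw [coactTree, coactAux, map_list_sum, List.map_map]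
  refine congrArg List.sum (List.map_congr_left fun m _ => ?_)
  simp [coactClose, bPlus_forest, MForest.components, HCon.forest, toHCon]

lemma coactAux_cons (c r : PForest) : coactAux k (.cons c r) =
    ((bPlus k).rTensor _ (coactAux k c) + 1 ⊗ₜ[k] coactTree k c) * coactAux k r := by
  have h1 : (bPlus k).rTensor _ (coactAux k c) =
      (c.markings.map fun m => HCK.tree (RTree.mk m.rootComponent) ⊗ₜ[k]
    (HCon.forest m.otherComponents ⊗ₜ[k] HCK.forest m.contract)).sum := by
    rw [coactAux, map_list_sum, List.map_map]
    simp [Function.comp_def, bPlus_forest]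
  have h2 : (1 : HCK k) ⊗ₜ[k] coactTree k c =
      (c.markings.map fun m => (1 : HCK k) ⊗ₜ[k] (HCon.forest m.components ⊗ₜ[k]
        HCK.tree (RTree.mk m.contract))).sum := by
    change TensorProduct.mk k _ _ 1 _ = _
    rw [coactTree, map_list_sum, List.map_map]
    simp [Function.comp_def]
  rw [add_mul, h1, h2, coactAux, coactAux, sum_markings_cons, ← sum_mul_sum, ← sum_mul_sum]
  simp [MForest.rootComponent, MForest.otherComponents, MForest.contract, MForest.components,
    HCK.forest, HCon.forest, HCK.forest_append, HCon.forest_append, mul_assoc]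

lemma coactAux_move {c d : PForest} (h : PForest.Move c d) : coactAux k c = coactAux k d := by
  induction h with
  | swap c d r => simp only [coactAux_cons]; ring
  | branches r h ih => simp only [coactAux_cons, coactTree_eq, ih]
  | rest c h ih => simp only [coactAux_cons, ih]

variable (k) in
/-- The left coaction `Φ`, extended from trees to an algebra morphism. -/
def coaction : HCK k →ₐ[k] HCon k ⊗[k] HCK k :=
  HCK.lift (Quot.lift (coactTree k) fun _ _ h => by
    rw [coactTree_eq, coactTree_eq, coactAux_move h])

/-! ### Characters, operators, biderivations -/

/-- Infinitesimal characters of `𝓗`. -/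
def IsInfinitesimalCharacter (a : HCon k →ₗ[k] k) : Prop :=
  ∀ x y, a (x * y) = a x * HCon.counit y + HCon.counit x * a y

/-- The operator `(a ⊗ Id) ∘ Φ`. -/
def transposeL (a : HCon k →ₗ[k] k) : HCK k →ₗ[k] HCK k :=
  (TensorProduct.lid k (HCK k)).toLinearMap ∘ₗ TensorProduct.map a LinearMap.id ∘ₗ
    (coaction k).toLinearMap

/-- The operator `L_a : b ↦ a ⋆ b = (a ⊗ b) ∘ Φ` on linear forms. -/
def leftMul (a : HCon k →ₗ[k] k) : Module.Dual k (HCK k) →ₗ[k] Module.Dual k (HCK k) where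
  toFun b := LinearMap.mul' k k ∘ₗ TensorProduct.map a b ∘ₗ (coaction k).toLinearMap
  map_add' b c := by simp only [TensorProduct.map_add_right, LinearMap.add_comp, LinearMap.comp_add]
  map_smul' r b := by
    simp only [TensorProduct.map_smul_right, LinearMap.smul_comp, LinearMap.comp_smul,
      RingHom.id_apply]

section Bialgebra

variable {C : Type*} [CommRing C]

/-- Biderivations of a bialgebra: derivations that are coderivations. -/
structure IsBiderivation [Bialgebra k C] (D : C →ₗ[k] C) : Prop where
  leibniz : ∀ x y, D (x * y) = D x * y + x * D y
  coleibniz : Coalgebra.comul ∘ₗ D =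
    (TensorProduct.map D LinearMap.id + TensorProduct.map LinearMap.id D) ∘ₗ Coalgebra.comul

/-- The convolution product of linear forms. -/
def conv [Bialgebra k C] (b c : Module.Dual k C) : Module.Dual k C :=
  (WithConv.toConv b * WithConv.toConv c).ofConv

/-- The coproduct of the complete dual: the transpose of the product, with values in the completed
tensor square `(C ⊗ C)*` of `C*`. -/
def dualComul [Algebra k C] : Module.Dual k C →ₗ[k] Module.Dual k (C ⊗[k] C) :=
  (LinearMap.mul' k C).dualMap

/-- The completed tensor product, on `(C ⊗ C)*`, of the transposes of `f` and `g`. -/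
def dualTensor [Algebra k C] (f g : C →ₗ[k] C) :
    Module.Dual k (C ⊗[k] C) →ₗ[k] Module.Dual k (C ⊗[k] C) :=
  (TensorProduct.map f g).dualMap

/-- `L` is a biderivation of the complete dual `C*`, where `T` is the operator on `C` of which `L`
is the transpose, so that `L` is continuous and `L ⊗ Id` acts on the completed tensor square. -/
structure IsDualBiderivation [Bialgebra k C] (T : C →ₗ[k] C)
    (L : Module.Dual k C →ₗ[k] Module.Dual k C) : Prop where
  transpose : L = T.dualMap
  leibniz : ∀ b c, L (conv b c) = conv (L b) c + conv b (L c)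
  coleibniz : ∀ b, dualComul (L b) =
    dualTensor T LinearMap.id (dualComul b) + dualTensor LinearMap.id T (dualComul b)

/-- `L` is an automorphism of the complete Hopf algebra `C*`, where `T` is the operator on `C` of
which `L` is the transpose. The unit of `C*` is the counit of `C`, the counit of `C*` is the
evaluation at `1`, and the antipode of `C*` is the transpose of the antipode of `C`. -/
structure IsDualAutomorphism [HopfAlgebra k C] (T : C →ₗ[k] C)
    (L : Module.Dual k C →ₗ[k] Module.Dual k C) : Prop where
  transpose : L = T.dualMap
  bijective : Function.Bijective L
  map_conv : ∀ b c, L (conv b c) = conv (L b) (L c)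
  map_unit : L Coalgebra.counit = Coalgebra.counit
  map_comul : ∀ b, dualComul (L b) = dualTensor T T (dualComul b)
  map_counit : ∀ b, L b 1 = b 1
  map_antipode : ∀ b, L (b ∘ₗ HopfAlgebra.antipode k) = L b ∘ₗ HopfAlgebra.antipode k

end Bialgebra

/-! ### Graded duals -/

/-- Homogeneous elements of the Connes–Kreimer algebra, graded by the number of vertices. -/
def HCK.IsHomogeneous (x : HCK k) (n : ℕ) : Prop :=
  MvPolynomial.IsWeightedHomogeneous (R := k) RTree.vertices x n

/-- Homogeneous elements of `𝓗`, graded by the number of edges. -/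
def HCon.IsHomogeneous (x : HCon k) (n : ℕ) : Prop :=
  MvPolynomial.IsWeightedHomogeneous (R := k)
    (fun t : {t : RTree // t ≠ RTree.bullet} => t.1.edges) x n

variable (k) in
/-- The graded dual of the Connes–Kreimer algebra: the linear forms that vanish in all large
degrees. -/
def HCK.gradedDual : Submodule k (Module.Dual k (HCK k)) where
  carrier := {b | ∃ N, ∀ n ≥ N, ∀ x, HCK.IsHomogeneous x n → b x = 0}
  zero_mem' := ⟨0, fun _ _ _ _ => rfl⟩
  add_mem' := by
    rintro b c ⟨N, hN⟩ ⟨M, hM⟩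
    refine ⟨max N M, fun n hn x hx => ?_⟩
    rw [LinearMap.add_apply, hN n (le_of_max_le_left hn) x hx,
      hM n (le_of_max_le_right hn) x hx, add_zero]
  smul_mem' := by
    rintro r b ⟨N, hN⟩
    refine ⟨N, fun n hn x hx => ?_⟩
    rw [LinearMap.smul_apply, hN n hn x hx, smul_zero]

/-- Membership in the graded dual of `𝓗`. -/
def HCon.MemGradedDual (a : HCon k →ₗ[k] k) : Prop :=
  ∃ N, ∀ n ≥ N, ∀ x, HCon.IsHomogeneous x n → a x = 0

variable (k) in
/-- The canonical map from the tensor square of the graded dual of the Connes–Kreimer algebra to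
the linear forms on its tensor square. -/
def gradedDualPairing : HCK.gradedDual k ⊗[k] HCK.gradedDual k →ₗ[k]
    Module.Dual k (HCK k ⊗[k] HCK k) :=
  TensorProduct.dualDistrib k (HCK k) (HCK k) ∘ₗ
    TensorProduct.map (HCK.gradedDual k).subtype (HCK.gradedDual k).subtype

/-- `L` maps the graded dual of the Connes–Kreimer algebra to itself and is a biderivation of this
Hopf algebra, whose product is the convolution and whose coproduct, the transpose of the product,
takes its values in the tensor square of the graded dual. -/
def IsGradedDualBiderivation
    (L : Module.Dual k (HCK k) →ₗ[k] Module.Dual k (HCK k)) : Prop :=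
  ∃ hL : ∀ b ∈ HCK.gradedDual k, L b ∈ HCK.gradedDual k,
    (∀ b ∈ HCK.gradedDual k, ∀ c ∈ HCK.gradedDual k, conv b c ∈ HCK.gradedDual k ∧
      L (conv b c) = conv (L b) c + conv b (L c)) ∧
    ∀ b ∈ HCK.gradedDual k,
      (∃ z, gradedDualPairing k z = dualComul b) ∧
      ∀ z, gradedDualPairing k z = dualComul b →
        gradedDualPairing k ((L.restrict hL).rTensor _ z + (L.restrict hL).lTensor _ z) =
          dualComul (L b)

end

end ForestHopf

open ForestHopf

/-!
Write `B₊` for the grafting of a forest on a new root and `Φ` for the coaction. The heart of the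
matter is that `Δ` is colinear: `(Id ⊗ Δ) ∘ Φ = Φ₂ ∘ Δ`, where `Φ₂` applies `Φ` to both factors and
multiplies the two coefficients in `𝓗`. Applying an infinitesimal character to the coefficients then
gives a biderivation, and applying a character gives a bialgebra endomorphism, which commutes with
the antipode.

Colinearity is proved by induction along `B₊`. As `Φ(x)` does not determine `Φ(B₊ x)`, the coaction
is refined to an algebra morphism `Ψ : x ↦ ∑ c ⊗ h ⊗ y`, where `B₊(c)` is the component of the root
in a subforest of `B₊ x`. Then `Φ(B₊ x) = ∑ B₊(c) h ⊗ B₊(y)` is determined by `Ψ(x)`, and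
`Ψ(B₊ x) = (B₊ ⊗ Id) Ψ(x) + 1 ⊗ Φ(B₊ x)`, according to whether the edge under the root of `B₊ x`
belongs to the subforest. Together with `Δ(B₊ x) = B₊ x ⊗ 1 + (Id ⊗ B₊) Δ(x)`, this propagates the
colinearity of `Δ` for `Φ` and for `Ψ` simultaneously.

The counit `ε` of `𝓗` acts as the identity, and a character `φ` agrees with `ε` in degree `0`. As
`Φ` preserves the total degree, `φ - ε` acts by an operator that lowers the degree, so `φ` acts
bijectively. The assertions on the duals follow by transposition; the transpose of the product maps
the graded dual to its tensor square because each degree contains finitely many forests.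
-/

namespace ForestHopf

noncomputable section

/-! ### Locally unipotent operators -/

section LocallyUnipotent

variable {k M : Type*} [Ring k] [AddCommGroup M] [Module k M]

lemma bijective_of_forall_exists_one_sub_pow_eq_zero {T : Module.End k M}
    (h : ∀ x, ∃ n : ℕ, ((1 - T) ^ n) x = 0) : Function.Bijective T := by
  refine ⟨(injective_iff_map_eq_zero T).2 fun x hx => ?_, fun x => ?_⟩
  · obtain ⟨n, hn⟩ := h x
    have geom := LinearMap.congr_fun (geom_sum_mul_neg (1 - T) n) x
    simpa [hx, hn] using geom.symm
  · obtain ⟨n, hn⟩ := h x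
    have geom := LinearMap.congr_fun (mul_neg_geom_sum (1 - T) n) x
    exact ⟨(∑ i ∈ Finset.range n, (1 - T) ^ i) x, by
      simpa only [sub_sub_cancel, Module.End.mul_apply, LinearMap.sub_apply, hn, sub_zero,
        Module.End.one_apply] using geom⟩

variable {ℳ : ℕ → Submodule k M}

lemma pow_apply_eq_zero_of_mem_iSup_lt {J : Module.End k M}
    (hJ : ∀ n, ∀ x ∈ ℳ n, J x ∈ ⨆ i < n, ℳ i) (n : ℕ) :
    ∀ x ∈ ⨆ i < n, ℳ i, (J ^ n) x = 0 := by
  induction n with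
  | zero => simp
  | succ n ih =>
    intro x hx
    have lower : ⨆ i < n + 1, ℳ i ≤ (⨆ i < n, ℳ i).comap J := by
      refine iSup₂_le fun i hi y hy => ?_
      have le : ⨆ j < i, ℳ j ≤ ⨆ j < n, ℳ j := biSup_mono fun j hj => by omega
      exact le (hJ i y hy)
    rw [pow_succ, Module.End.mul_apply]
    exact ih _ (lower hx)

lemma exists_mem_iSup_lt (hℳ : ⨆ n, ℳ n = ⊤) (x : M) : ∃ n, x ∈ ⨆ i < n, ℳ i := by
  have mono : Monotone fun n => ⨆ i < n, ℳ i := fun m n hmn =>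
    biSup_mono fun i hi => hi.trans_le hmn
  rw [← Submodule.mem_iSup_of_directed _ mono.directed_le]
  have le : ⨆ n, ℳ n ≤ ⨆ n, ⨆ i < n, ℳ i := iSup_mono' fun n =>
    ⟨n + 1, le_iSup₂_of_le n n.lt_succ_self le_rfl⟩
  exact le (hℳ ▸ Submodule.mem_top)

lemma bijective_of_sub_mem_iSup_lt (hℳ : ⨆ n, ℳ n = ⊤) {T : Module.End k M}
    (hT : ∀ n, ∀ x ∈ ℳ n, T x - x ∈ ⨆ i < n, ℳ i) : Function.Bijective T := by
  refine bijective_of_forall_exists_one_sub_pow_eq_zero fun x => ?_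
  obtain ⟨n, hn⟩ := exists_mem_iSup_lt hℳ x
  refine ⟨n, pow_apply_eq_zero_of_mem_iSup_lt (fun i y hy => ?_) n x hn⟩
  rw [← neg_sub, LinearMap.neg_apply]
  exact neg_mem (hT i y hy)

end LocallyUnipotent

variable {k : Type*} [CommRing k]

/-! ### Gradings -/

section Grading

lemma map_mem_of_isWeightedHomogeneous {σ A : Type*} [CommRing A] [Algebra k A]
    {𝒜 : ℕ → Submodule k A} [SetLike.GradedMonoid 𝒜] {w : σ → ℕ} {g : MvPolynomial σ k →ₐ[k] A}
    (hg : ∀ i, g (MvPolynomial.X i) ∈ 𝒜 (w i)) {p : MvPolynomial σ k} {n : ℕ}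
    (hp : MvPolynomial.IsWeightedHomogeneous w p n) : g p ∈ 𝒜 n := by
  rw [p.as_sum, map_sum]
  refine sum_mem fun d hd => ?_
  rw [MvPolynomial.aeval_unique g, MvPolynomial.aeval_monomial, ← Algebra.smul_def]
  refine Submodule.smul_mem _ _ ?_
  rw [← hp (MvPolynomial.mem_support_iff.1 hd), Finsupp.weight_apply]
  exact SetLike.prod_pow_mem_graded 𝒜 w (fun i => g (MvPolynomial.X i)) d fun i _ => hg i

variable {A B : Type*} [CommRing A] [CommRing B] [Algebra k A] [Algebra k B]

/-- The total grading of a tensor product: its component of degree `n` is spanned by the `a ⊗ b`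
with `a` and `b` homogeneous and `deg a + deg b = n`. -/
def tensorGrading (𝒜 : ℕ → Submodule k A) (ℬ : ℕ → Submodule k B) (n : ℕ) :
    Submodule k (A ⊗[k] B) :=
  Submodule.span k {z | ∃ i j, i + j = n ∧ ∃ a ∈ 𝒜 i, ∃ b ∈ ℬ j, a ⊗ₜ[k] b = z}

variable {𝒜 : ℕ → Submodule k A} {ℬ : ℕ → Submodule k B}

lemma tmul_mem_tensorGrading {i j : ℕ} {a : A} {b : B} (ha : a ∈ 𝒜 i) (hb : b ∈ ℬ j) :
    a ⊗ₜ[k] b ∈ tensorGrading 𝒜 ℬ (i + j) :=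
  Submodule.subset_span ⟨i, j, rfl, a, ha, b, hb, rfl⟩

instance tensorGrading.gradedMonoid [SetLike.GradedMonoid 𝒜] [SetLike.GradedMonoid ℬ] :
    SetLike.GradedMonoid (tensorGrading 𝒜 ℬ) where
  one_mem := Submodule.subset_span
    ⟨0, 0, add_zero 0, 1, SetLike.GradedOne.one_mem, 1, SetLike.GradedOne.one_mem,
      Algebra.TensorProduct.one_def.symm⟩
  mul_mem m n x y := by
    refine LinearMap.BilinMap.apply_apply_mem_of_mem_span (tensorGrading 𝒜 ℬ (m + n)) _ _
      (LinearMap.mul k (A ⊗[k] B)) ?_ x y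
    rintro _ ⟨i, j, rfl, a, ha, b, hb, rfl⟩ _ ⟨i', j', rfl, a', ha', b', hb', rfl⟩
    exact Submodule.subset_span ⟨i + i', j + j', add_add_add_comm .., a * a',
      SetLike.mul_mem_graded ha ha', b * b', SetLike.mul_mem_graded hb hb',
      (Algebra.TensorProduct.tmul_mul_tmul ..).symm⟩

end Grading

/-! ### Slicing a tensor product by a linear form -/

section Slice

variable {A V W : Type*} [CommRing A] [Algebra k A] [AddCommGroup V] [Module k V]
  [AddCommGroup W] [Module k W]

/-- The contraction `a ⊗ Id` of the first factor by a linear form, `x ⊗ v ↦ a(x) v`. -/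
def slice (a : A →ₗ[k] k) : A ⊗[k] W →ₗ[k] W := (TensorProduct.lid k W).toLinearMap ∘ₗ a.rTensor W

@[simp] lemma slice_tmul (a : A →ₗ[k] k) (x : A) (v : W) : slice a (x ⊗ₜ[k] v) = a x • v := by
  simp [slice]

lemma slice_sub (a b : A →ₗ[k] k) : slice (W := W) (a - b) = slice a - slice b := by
  rw [slice, slice, slice, LinearMap.rTensor_sub, LinearMap.comp_sub]

lemma slice_lTensor (a : A →ₗ[k] k) (f : V →ₗ[k] W) (z : A ⊗[k] V) :
    slice a (f.lTensor A z) = f (slice a z) := by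
  have : slice a ∘ₗ f.lTensor A = f ∘ₗ slice a := by ext; simp
  exact LinearMap.congr_fun this z

lemma mul'_comp_map (a : A →ₗ[k] k) (b : W →ₗ[k] k) :
    LinearMap.mul' k k ∘ₗ TensorProduct.map a b = b ∘ₗ slice a := by
  ext; simp

variable {B : Type*} [CommRing B] [Algebra k B]

lemma slice_mul_of_algHom (φ : A →ₐ[k] k) (z w : A ⊗[k] B) :
    slice φ.toLinearMap (z * w) = slice φ.toLinearMap z * slice φ.toLinearMap w :=
  map_mul ((Algebra.TensorProduct.lid k B).toAlgHom.comp
    (Algebra.TensorProduct.map φ (AlgHom.id k B))) z w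

lemma slice_mul_of_leibniz {ε : A →ₐ[k] k} {a : A →ₗ[k] k}
    (ha : ∀ x y, a (x * y) = a x * ε y + ε x * a y) (z w : A ⊗[k] B) :
    slice a (z * w) =
      slice a z * slice ε.toLinearMap w + slice ε.toLinearMap z * slice a w := by
  have : (LinearMap.mul k (A ⊗[k] B)).compr₂ (slice a) =
      (LinearMap.mul k B).compl₁₂ (slice a) (slice ε.toLinearMap) +
        (LinearMap.mul k B).compl₁₂ (slice ε.toLinearMap) (slice a) := by
    ext x y x' y'
    simp [ha, add_smul, smul_smul, mul_comm]
  exact LinearMap.congr_fun₂ this z w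

variable {𝒜 : ℕ → Submodule k A} {ℬ : ℕ → Submodule k B}

lemma slice_mem_iSup_lt {a : A →ₗ[k] k} (ha : ∀ x ∈ 𝒜 0, a x = 0) {n : ℕ} {z : A ⊗[k] B}
    (hz : z ∈ tensorGrading 𝒜 ℬ n) : slice a z ∈ ⨆ i < n, ℬ i := by
  suffices tensorGrading 𝒜 ℬ n ≤ (⨆ i < n, ℬ i).comap (slice a) from this hz
  refine Submodule.span_le.2 ?_
  rintro _ ⟨i, j, hij, x, hx, y, hy, rfl⟩
  rw [SetLike.mem_coe, Submodule.mem_comap, slice_tmul]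
  obtain rfl | hi := Nat.eq_zero_or_pos i
  · rw [ha x hx, zero_smul]
    exact zero_mem _
  · exact Submodule.smul_mem _ _ (Submodule.mem_iSup_of_mem j
      (Submodule.mem_iSup_of_mem (by omega) hy))

lemma apply_slice_eq_zero_of_mem_tensorGrading {a : A →ₗ[k] k} {b : B →ₗ[k] k} {M N : ℕ}
    (ha : ∀ i ≥ M, ∀ x ∈ 𝒜 i, a x = 0) (hb : ∀ j ≥ N, ∀ y ∈ ℬ j, b y = 0) {n : ℕ}
    (hn : M + N ≤ n) {z : A ⊗[k] B} (hz : z ∈ tensorGrading 𝒜 ℬ n) : b (slice a z) = 0 := by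
  suffices tensorGrading 𝒜 ℬ n ≤ LinearMap.ker (b ∘ₗ slice a) from this hz
  refine Submodule.span_le.2 ?_
  rintro _ ⟨i, j, hij, x, hx, y, hy, rfl⟩
  rw [SetLike.mem_coe, LinearMap.mem_ker, LinearMap.comp_apply, slice_tmul, map_smul, smul_eq_mul]
  obtain hi | hj : M ≤ i ∨ N ≤ j := by omega
  · rw [ha i hi x hx, zero_mul]
  · rw [hb j hj y hy, mul_zero]

end Slice

/-! ### Coactions on bialgebras -/

section Coaction

open Algebra.TensorProduct

variable {A B : Type*} [CommRing A] [Algebra k A] [CommRing B]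

/-- The diagonal coaction on `B ⊗ B` of a coaction `δ` on the algebra `B`, where the coefficients in
`A` are multiplied: `x ⊗ y ↦ x₍₋₁₎ y₍₋₁₎ ⊗ (x₍₀₎ ⊗ y₍₀₎)`. -/
def tensorCoaction [Algebra k B] (δ : B →ₐ[k] A ⊗[k] B) : B ⊗[k] B →ₐ[k] A ⊗[k] (B ⊗[k] B) :=
  productMap ((map (AlgHom.id k A) includeLeft).comp δ) ((map (AlgHom.id k A) includeRight).comp δ)

lemma tensorCoaction_tmul [Algebra k B] (δ : B →ₐ[k] A ⊗[k] B) (x y : B) :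
    tensorCoaction δ (x ⊗ₜ[k] y) =
      includeLeft.toLinearMap.lTensor A (δ x) * includeRight.toLinearMap.lTensor A (δ y) :=
  productMap_apply_tmul ..

/-- The coproduct and the counit of the bialgebra `B` are colinear for `δ : B → A ⊗ B`, where the
coaction on `B ⊗ B` is the diagonal one and the coaction on `k` is trivial. -/
structure IsColinearBialgebra [Bialgebra k B] (δ : B →ₐ[k] A ⊗[k] B) : Prop where
  comul_coaction : ∀ x, Coalgebra.comul.lTensor A (δ x) = tensorCoaction δ (Coalgebra.comul x)
  counit_coaction : ∀ x, Coalgebra.counit.lTensor A (δ x) = 1 ⊗ₜ[k] (Coalgebra.counit x : k)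

lemma slice_tensorCoaction_of_leibniz [Algebra k B] {δ : B →ₐ[k] A ⊗[k] B} {ε : A →ₐ[k] k}
    {a : A →ₗ[k] k} (ha : ∀ x y, a (x * y) = a x * ε y + ε x * a y) :
    slice a ∘ₗ (tensorCoaction δ).toLinearMap =
      TensorProduct.map (slice a ∘ₗ δ.toLinearMap) (slice ε.toLinearMap ∘ₗ δ.toLinearMap) +
        TensorProduct.map (slice ε.toLinearMap ∘ₗ δ.toLinearMap) (slice a ∘ₗ δ.toLinearMap) := by
  ext x y
  simp [tensorCoaction_tmul, slice_mul_of_leibniz ha, slice_lTensor]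

/-- The endomorphism `(φ ⊗ Id) ∘ δ` of the algebra `B` attached to a character `φ` of `A`. -/
def characterHom [Algebra k B] (δ : B →ₐ[k] A ⊗[k] B) (φ : A →ₐ[k] k) : B →ₐ[k] B :=
  ((Algebra.TensorProduct.lid k B).toAlgHom.comp (map φ (AlgHom.id k B))).comp δ

lemma characterHom_apply [Algebra k B] (δ : B →ₐ[k] A ⊗[k] B) (φ : A →ₐ[k] k) (x : B) :
    characterHom δ φ x = slice φ.toLinearMap (δ x) := rfl

lemma slice_tensorCoaction_of_algHom [Algebra k B] (δ : B →ₐ[k] A ⊗[k] B) (φ : A →ₐ[k] k) :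
    slice φ.toLinearMap ∘ₗ (tensorCoaction δ).toLinearMap =
      TensorProduct.map (characterHom δ φ).toLinearMap (characterHom δ φ).toLinearMap := by
  ext x y
  simp [tensorCoaction_tmul, slice_mul_of_algHom, slice_lTensor, characterHom_apply]

variable [Bialgebra k B] {δ : B →ₐ[k] A ⊗[k] B}

lemma IsColinearBialgebra.comul_slice (hδ : IsColinearBialgebra δ) (a : A →ₗ[k] k) (x : B) :
    Coalgebra.comul (slice a (δ x)) = slice a (tensorCoaction δ (Coalgebra.comul x)) := by
  rw [← slice_lTensor, hδ.comul_coaction]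

lemma IsColinearBialgebra.isBiderivation_slice (hδ : IsColinearBialgebra δ) {ε : A →ₐ[k] k}
    (hε : slice ε.toLinearMap ∘ₗ δ.toLinearMap = LinearMap.id) {a : A →ₗ[k] k}
    (ha : ∀ x y, a (x * y) = a x * ε y + ε x * a y) :
    IsBiderivation (slice a ∘ₗ δ.toLinearMap) where
  leibniz x y := by
    have counital (z : B) : slice ε.toLinearMap (δ z) = z := LinearMap.congr_fun hε z
    simp [slice_mul_of_leibniz ha, counital]
  coleibniz := by
    rw [← hε, ← slice_tensorCoaction_of_leibniz ha]
    exact LinearMap.ext fun x => hδ.comul_slice a x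

/-- A character of `A` acts on a colinear bialgebra by a bialgebra endomorphism. -/
def IsColinearBialgebra.characterBialgHom (hδ : IsColinearBialgebra δ) (φ : A →ₐ[k] k) :
    B →ₐc[k] B :=
  BialgHom.ofAlgHom (characterHom δ φ)
    (AlgHom.ext fun x => by
      change Coalgebra.counit (slice φ.toLinearMap (δ x)) = Coalgebra.counit x
      rw [← slice_lTensor, hδ.counit_coaction, slice_tmul]
      simp)
    (AlgHom.ext fun x => ((hδ.comul_slice φ.toLinearMap x).trans
      (LinearMap.congr_fun (slice_tensorCoaction_of_algHom δ φ) (Coalgebra.comul x))).symm)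

end Coaction

/-! ### Transposition -/

section Dual

open WithConv in
lemma bialgHom_antipode {k A B : Type*} [CommSemiring k] [Semiring A] [Semiring B]
    [HopfAlgebra k A] [HopfAlgebra k B] (f : A →ₐc[k] B) (x : A) :
    f (HopfAlgebra.antipode k x) = HopfAlgebra.antipode k (f x) := by
  set F : A →ₗ[k] B := (f : A →ₐ[k] B).toLinearMap
  -- Both composites are convolution inverses of `f`.
  have left_inv : toConv (F ∘ₗ HopfAlgebra.antipode k) * toConv F = 1 := by
    have := LinearMap.algHom_comp_convMul_distrib (f : A →ₐ[k] B)
      (toConv (HopfAlgebra.antipode k (A := A))) (toConv LinearMap.id)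
    rw [LinearMap.antipode_mul_id] at this
    refine WithConv.ofConv_injective (this.symm.trans ?_)
    exact LinearMap.ext fun y => (f : A →ₐ[k] B).commutes _
  have right_inv : toConv F * toConv (HopfAlgebra.antipode k ∘ₗ F) = 1 := by
    have := LinearMap.convMul_comp_coalgHom_distrib
      (toConv LinearMap.id) (toConv (HopfAlgebra.antipode k (A := B))) (f : A →ₗc[k] B)
    rw [LinearMap.id_mul_antipode] at this
    refine WithConv.ofConv_injective (this.symm.trans ?_)
    ext y
    simp [LinearMap.convOne_def]
  exact LinearMap.congr_fun (congrArg WithConv.ofConv (left_inv_eq_right_inv left_inv right_inv)) x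

variable {C : Type*} [CommRing C]

lemma conv_apply [Bialgebra k C] (b c : Module.Dual k C) (x : C) :
    conv b c x = c (slice b (Coalgebra.comul x)) :=
  LinearMap.congr_fun (mul'_comp_map b c) (Coalgebra.comul x)

lemma conv_eq_comp [Bialgebra k C] (b c : Module.Dual k C) :
    conv b c = LinearMap.mul' k k ∘ₗ TensorProduct.map b c ∘ₗ Coalgebra.comul := rfl

lemma IsBiderivation.isDualBiderivation_dualMap [Bialgebra k C] {T : C →ₗ[k] C}
    (hT : IsBiderivation T) : IsDualBiderivation T T.dualMap where
  transpose := rfl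
  leibniz b c := by
    simp only [LinearMap.dualMap_apply', conv_eq_comp, LinearMap.comp_assoc, hT.coleibniz]
    simp only [← LinearMap.comp_assoc, LinearMap.comp_add, LinearMap.add_comp]
    simp only [LinearMap.comp_assoc _ _ (LinearMap.mul' k k), ← TensorProduct.map_comp,
      LinearMap.comp_id]
  coleibniz b := by
    ext x y
    simp [dualComul, dualTensor, hT.leibniz]

lemma isDualAutomorphism_dualMap [HopfAlgebra k C] (e : C ≃ₐc[k] C) :
    IsDualAutomorphism (e : C →ₗ[k] C) (e : C →ₗ[k] C).dualMap where
  transpose := rfl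
  bijective := (e : C ≃ₗ[k] C).dualMap.bijective
  map_conv b c := by
    simp only [LinearMap.dualMap_apply', conv_eq_comp, TensorProduct.map_comp, LinearMap.comp_assoc]
    congr 2
    exact (CoalgHomClass.map_comp_comul e).symm
  map_unit := CoalgHomClass.counit_comp e
  map_comul b := by
    ext x y
    simp [dualComul, dualTensor]
  map_counit b := by simp
  map_antipode b := by
    ext x
    exact congrArg b (bialgHom_antipode (e : C →ₐc[k] C) x).symm

lemma dual_tensor_eq_sum_of_finite_support {ι M : Type*} [AddCommGroup M] [Module k M]
    (b : Module.Basis ι k M) (S : Finset ι) {F : Module.Dual k (M ⊗[k] M)}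
    (hF : ∀ i j, i ∉ S ∨ j ∉ S → F (b i ⊗ₜ[k] b j) = 0) :
    F = ∑ i ∈ S, ∑ j ∈ S,
      F (b i ⊗ₜ[k] b j) • TensorProduct.dualDistrib k M M (b.coord i ⊗ₜ[k] b.coord j) := by
  classical
  refine (b.tensorProduct b).ext fun ⟨i, j⟩ => ?_
  by_cases hij : i ∈ S ∧ j ∈ S
  · simp [Module.Basis.tensorProduct_apply, Finsupp.single_apply, hij]
  · rw [not_and_or] at hij
    rw [Module.Basis.tensorProduct_apply, hF i j hij]
    have vanish : ∀ i' ∈ S, ∀ j' ∈ S, i ≠ i' ∨ j ≠ j' := by grind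
    symm
    simp only [LinearMap.sum_apply]
    refine Finset.sum_eq_zero fun i' hi' => Finset.sum_eq_zero fun j' hj' => ?_
    obtain h | h := vanish i' hi' j' hj' <;> simp [h]

end Dual

/-! ### Colinearity of the Connes–Kreimer coproduct -/

section RootCoaction

open Algebra.TensorProduct

lemma RTree.mk_surjective : Function.Surjective RTree.mk := Quot.exists_rep

lemma coaction_tree (c : PForest) : coaction k (HCK.tree (RTree.mk c)) = coactTree k c :=
  HCK.lift_tree _ _

variable (k) in
/-- The refinement `Ψ` of the coaction that keeps the component of the root apart: on a forest, the
sum of `c ⊗ s' ⊗ f/s`, where `c` is obtained from the component of the root of `B₊(f)` by removing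
the root, and `s'` is the product of the other components of `s`. -/
def rootCoaction : HCK k →ₐ[k] HCK k ⊗[k] (HCon k ⊗[k] HCK k) :=
  HCK.lift (Quot.lift (fun c => (bPlus k).rTensor _ (coactAux k c) + 1 ⊗ₜ[k] coactTree k c)
    fun _ _ h => by simp only [coactTree_eq, coactAux_move h])

lemma rootCoaction_tree (c : PForest) : rootCoaction k (HCK.tree (RTree.mk c)) =
    (bPlus k).rTensor _ (coactAux k c) + 1 ⊗ₜ[k] coactTree k c :=
  HCK.lift_tree _ _

lemma rootCoaction_forest (c : PForest) : rootCoaction k (HCK.forest c) = coactAux k c := by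
  induction c with
  | nil =>
    simp [HCK.forest, coactAux, PForest.markings, MForest.rootComponent,
      MForest.otherComponents, MForest.contract, HCon.forest, one_def]
  | cons c r _ ih => rw [HCK.forest, map_mul, rootCoaction_tree, ih, coactAux_cons]

lemma rootCoaction_bPlus (x : HCK k) : rootCoaction k (bPlus k x) =
    (bPlus k).rTensor _ (rootCoaction k x) + 1 ⊗ₜ[k] coaction k (bPlus k x) := by
  have : (rootCoaction k).toLinearMap ∘ₗ bPlus k =
      (bPlus k).rTensor _ ∘ₗ (rootCoaction k).toLinearMap +
        TensorProduct.mk k _ _ 1 ∘ₗ (coaction k).toLinearMap ∘ₗ bPlus k := by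
    refine HCK.linearMap_ext fun c => ?_
    simp [bPlus_forest, coaction_tree, rootCoaction_forest, rootCoaction_tree]
  exact LinearMap.congr_fun this x

section AbsorbRoot

variable {U V W : Type*} [AddCommGroup U] [Module k U] [AddCommGroup V] [Module k V]
  [AddCommGroup W] [Module k W]

/-- The map `x ⊗ h ⊗ v ↦ B₊(x) h ⊗ g(v)`, which grafts the first factor on a root and puts the
resulting tree back among the other components. -/
def absorbRoot (g : V →ₗ[k] W) : HCK k ⊗[k] (HCon k ⊗[k] V) →ₗ[k] HCon k ⊗[k] W :=
  TensorProduct.map (LinearMap.mul' k (HCon k) ∘ₗ (toHCon.toLinearMap ∘ₗ bPlus k).rTensor (HCon k))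
    g ∘ₗ (TensorProduct.assoc k (HCK k) (HCon k) V).symm.toLinearMap

@[simp] lemma absorbRoot_tmul (g : V →ₗ[k] W) (x : HCK k) (h : HCon k) (v : V) :
    absorbRoot g (x ⊗ₜ[k] (h ⊗ₜ[k] v)) = (toHCon (bPlus k x) * h) ⊗ₜ[k] g v := by
  simp [absorbRoot]

lemma absorbRoot_add (f g : V →ₗ[k] W) : absorbRoot (f + g) = absorbRoot f + absorbRoot g := by
  rw [absorbRoot, TensorProduct.map_add_right, LinearMap.add_comp, absorbRoot, absorbRoot]

lemma lTensor_absorbRoot (f : V →ₗ[k] W) (g : U →ₗ[k] V) (w : HCK k ⊗[k] (HCon k ⊗[k] U)) :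
    f.lTensor (HCon k) (absorbRoot g w) = absorbRoot (f ∘ₗ g) w := by
  have : f.lTensor (HCon k) ∘ₗ absorbRoot g = absorbRoot (f ∘ₗ g) := by ext; simp
  exact LinearMap.congr_fun this w

lemma absorbRoot_comp (f : V →ₗ[k] W) (g : U →ₗ[k] V) (w : HCK k ⊗[k] (HCon k ⊗[k] U)) :
    absorbRoot (f ∘ₗ g) w = absorbRoot f ((g.lTensor (HCon k)).lTensor (HCK k) w) := by
  have : absorbRoot (f ∘ₗ g) = absorbRoot f ∘ₗ (g.lTensor (HCon k)).lTensor (HCK k) := by ext; simp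
  exact LinearMap.congr_fun this w

end AbsorbRoot

lemma coactClose_eq_absorbRoot : coactClose k = absorbRoot (bPlus k) := by
  ext x h y
  simp [coactClose]

lemma coaction_bPlus (x : HCK k) :
    coaction k (bPlus k x) = absorbRoot (bPlus k) (rootCoaction k x) := by
  have : (coaction k).toLinearMap ∘ₗ bPlus k =
      absorbRoot (bPlus k) ∘ₗ (rootCoaction k).toLinearMap := by
    refine HCK.linearMap_ext fun c => ?_
    simp [bPlus_forest, coaction_tree, rootCoaction_forest, coactTree_eq, coactClose_eq_absorbRoot]
  exact LinearMap.congr_fun this x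

variable (k) in
lemma comul_comp_bPlus : Coalgebra.comul ∘ₗ bPlus k =
    (includeLeft : HCK k →ₐ[k] HCK k ⊗[k] HCK k).toLinearMap ∘ₗ bPlus k +
      (bPlus k).lTensor (HCK k) ∘ₗ Coalgebra.comul :=
  LinearMap.ext HCK.comulHom_bPlus

lemma lTensor_comul_absorbRoot (w : HCK k ⊗[k] (HCon k ⊗[k] HCK k)) :
    Coalgebra.comul.lTensor (HCon k) (absorbRoot (bPlus k) w) =
      includeLeft.toLinearMap.lTensor (HCon k) (absorbRoot (bPlus k) w) +
        absorbRoot ((bPlus k).lTensor (HCK k))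
          ((Coalgebra.comul.lTensor (HCon k)).lTensor (HCK k) w) := by
  rw [lTensor_absorbRoot, lTensor_absorbRoot, comul_comp_bPlus, absorbRoot_add, LinearMap.add_apply,
    absorbRoot_comp ((bPlus k).lTensor (HCK k))]

lemma includeLeft_mul_absorbRoot (p : HCon k ⊗[k] HCK k) (w : HCK k ⊗[k] (HCon k ⊗[k] HCK k)) :
    includeLeft.toLinearMap.lTensor (HCon k) p *
        includeRight.toLinearMap.lTensor (HCon k) (absorbRoot (bPlus k) w) =
      absorbRoot ((bPlus k).lTensor (HCK k))
        (1 ⊗ₜ[k] includeLeft.toLinearMap.lTensor (HCon k) p *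
          (includeRight.toLinearMap.lTensor (HCon k)).lTensor (HCK k) w) := by
  have : (LinearMap.mul k (HCon k ⊗[k] (HCK k ⊗[k] HCK k))).compl₁₂
        (includeLeft.toLinearMap.lTensor (HCon k))
        (includeRight.toLinearMap.lTensor (HCon k) ∘ₗ absorbRoot (bPlus k)) =
      ((LinearMap.mul k (HCK k ⊗[k] (HCon k ⊗[k] (HCK k ⊗[k] HCK k)))).compl₁₂
        (TensorProduct.mk k _ _ 1 ∘ₗ includeLeft.toLinearMap.lTensor (HCon k))
        ((includeRight.toLinearMap.lTensor (HCon k)).lTensor (HCK k))).compr₂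
          (absorbRoot ((bPlus k).lTensor (HCK k))) := by
    ext h y x h' y'
    simp [mul_left_comm]
  exact LinearMap.congr_fun₂ this p w

variable (k) in
/-- The refinement by `Ψ` of the diagonal coaction, which keeps apart the component of the root of
the second factor. -/
def rootCoactionSq : HCK k ⊗[k] HCK k →ₐ[k] HCK k ⊗[k] (HCon k ⊗[k] (HCK k ⊗[k] HCK k)) :=
  productMap (S := HCK k ⊗[k] (HCon k ⊗[k] (HCK k ⊗[k] HCK k)))
    (includeRight.comp ((map (AlgHom.id k (HCon k)) includeLeft).comp (coaction k)))
    ((map (AlgHom.id k (HCK k)) (map (AlgHom.id k (HCon k)) includeRight)).comp (rootCoaction k))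

lemma rootCoactionSq_tmul (x y : HCK k) : rootCoactionSq k (x ⊗ₜ[k] y) =
    1 ⊗ₜ[k] includeLeft.toLinearMap.lTensor (HCon k) (coaction k x) *
      (includeRight.toLinearMap.lTensor (HCon k)).lTensor (HCK k) (rootCoaction k y) :=
  productMap_apply_tmul (S := HCK k ⊗[k] (HCon k ⊗[k] (HCK k ⊗[k] HCK k))) ..

lemma tensorCoaction_lTensor_bPlus (w : HCK k ⊗[k] HCK k) :
    tensorCoaction (coaction k) ((bPlus k).lTensor (HCK k) w) =
      absorbRoot ((bPlus k).lTensor (HCK k)) (rootCoactionSq k w) := by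
  have : (tensorCoaction (coaction k)).toLinearMap ∘ₗ (bPlus k).lTensor (HCK k) =
      absorbRoot ((bPlus k).lTensor (HCK k)) ∘ₗ (rootCoactionSq k).toLinearMap := by
    refine TensorProduct.ext' fun x y => ?_
    simp only [LinearMap.comp_apply, AlgHom.toLinearMap_apply, LinearMap.lTensor_tmul,
      tensorCoaction_tmul, rootCoactionSq_tmul, coaction_bPlus,
      includeLeft_mul_absorbRoot]
  exact LinearMap.congr_fun this w

lemma one_tmul_mul_rTensor {A B : Type*} [CommRing A] [Algebra k A] [CommRing B] [Algebra k B]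
    (f : A →ₗ[k] A) (b : B) (w : A ⊗[k] B) :
    1 ⊗ₜ[k] b * f.rTensor B w = f.rTensor B (1 ⊗ₜ[k] b * w) := by
  have : LinearMap.mulLeft k (1 ⊗ₜ[k] b) ∘ₗ f.rTensor B =
      f.rTensor B ∘ₗ LinearMap.mulLeft k (1 ⊗ₜ[k] b) := by ext; simp
  exact LinearMap.congr_fun this w

lemma lTensor_rTensor_comm {V V' W W' : Type*} [AddCommGroup V] [Module k V] [AddCommGroup V']
    [Module k V'] [AddCommGroup W] [Module k W] [AddCommGroup W'] [Module k W'] (f : V →ₗ[k] V')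
    (g : W →ₗ[k] W') (w : V ⊗[k] W) :
    g.lTensor V' (f.rTensor W w) = f.rTensor W' (g.lTensor V w) := by
  rw [← LinearMap.comp_apply, ← LinearMap.comp_apply, LinearMap.lTensor_comp_rTensor,
    LinearMap.rTensor_comp_lTensor]

lemma rootCoactionSq_lTensor_bPlus (w : HCK k ⊗[k] HCK k) :
    rootCoactionSq k ((bPlus k).lTensor (HCK k) w) =
      (bPlus k).rTensor _ (rootCoactionSq k w) +
        1 ⊗ₜ[k] tensorCoaction (coaction k) ((bPlus k).lTensor (HCK k) w) := by
  have : (rootCoactionSq k).toLinearMap ∘ₗ (bPlus k).lTensor (HCK k) =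
      (bPlus k).rTensor _ ∘ₗ (rootCoactionSq k).toLinearMap +
        TensorProduct.mk k _ _ 1 ∘ₗ (tensorCoaction (coaction k)).toLinearMap ∘ₗ
          (bPlus k).lTensor (HCK k) := by
    refine TensorProduct.ext' fun x y => ?_
    simp only [LinearMap.comp_apply, LinearMap.add_apply, AlgHom.toLinearMap_apply,
      LinearMap.lTensor_tmul, TensorProduct.mk_apply, tensorCoaction_tmul, rootCoactionSq_tmul,
      rootCoaction_bPlus, map_add, mul_add, lTensor_rTensor_comm, one_tmul_mul_rTensor,
      tmul_mul_tmul, mul_one]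
  exact LinearMap.congr_fun this w

lemma lTensor_includeRight_coaction_one :
    (includeRight : HCK k →ₐ[k] HCK k ⊗[k] HCK k).toLinearMap.lTensor (HCon k) (coaction k 1) =
      1 := by
  rw [map_one]
  exact map_one (map (AlgHom.id k (HCon k)) (includeRight : HCK k →ₐ[k] HCK k ⊗[k] HCK k))

lemma tensorCoaction_tmul_one (x : HCK k) : tensorCoaction (coaction k) (x ⊗ₜ[k] 1) =
    includeLeft.toLinearMap.lTensor (HCon k) (coaction k x) := by
  rw [tensorCoaction_tmul, lTensor_includeRight_coaction_one, mul_one]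

lemma rootCoactionSq_tmul_one (x : HCK k) : rootCoactionSq k (x ⊗ₜ[k] 1) =
    1 ⊗ₜ[k] includeLeft.toLinearMap.lTensor (HCon k) (coaction k x) := by
  have : (includeRight.toLinearMap.lTensor (HCon k)).lTensor (HCK k) (rootCoaction k 1) =
      (1 : HCK k ⊗[k] (HCon k ⊗[k] (HCK k ⊗[k] HCK k))) := by
    rw [map_one]
    exact map_one (map (AlgHom.id k (HCK k)) (map (AlgHom.id k (HCon k))
      (includeRight : HCK k →ₐ[k] HCK k ⊗[k] HCK k)))
  rw [rootCoactionSq_tmul, this, mul_one]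

lemma comul_bPlus (x : HCK k) : Coalgebra.comul (bPlus k x) =
    bPlus k x ⊗ₜ[k] 1 + (bPlus k).lTensor (HCK k) (Coalgebra.comul x) :=
  HCK.comulHom_bPlus x

lemma lTensor_comul_coaction_bPlus {x : HCK k}
    (hx : (Coalgebra.comul.lTensor (HCon k)).lTensor (HCK k) (rootCoaction k x) =
      rootCoactionSq k (Coalgebra.comul x)) :
    Coalgebra.comul.lTensor (HCon k) (coaction k (bPlus k x)) =
      tensorCoaction (coaction k) (Coalgebra.comul (bPlus k x)) := by
  rw [comul_bPlus, map_add, tensorCoaction_tmul_one, tensorCoaction_lTensor_bPlus, ← hx,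
    coaction_bPlus, lTensor_comul_absorbRoot]

lemma rootCoaction_comul (x : HCK k) :
    (Coalgebra.comul.lTensor (HCon k)).lTensor (HCK k) (rootCoaction k x) =
      rootCoactionSq k (Coalgebra.comul x) := by
  suffices (map (AlgHom.id k (HCK k)) (map (AlgHom.id k (HCon k)) (HCK.comulHom k))).comp
      (rootCoaction k) = (rootCoactionSq k).comp (HCK.comulHom k) from AlgHom.congr_fun this x
  refine HCK.algHom_ext_bPlus fun x hx => ?_
  change (Coalgebra.comul.lTensor (HCon k)).lTensor (HCK k) (rootCoaction k (bPlus k x)) =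
    rootCoactionSq k (Coalgebra.comul (bPlus k x))
  replace hx : (Coalgebra.comul.lTensor (HCon k)).lTensor (HCK k) (rootCoaction k x) =
    rootCoactionSq k (Coalgebra.comul x) := hx
  rw [rootCoaction_bPlus, map_add, lTensor_rTensor_comm, hx, LinearMap.lTensor_tmul,
    lTensor_comul_coaction_bPlus hx, comul_bPlus, map_add, map_add, rootCoactionSq_tmul_one,
    rootCoactionSq_lTensor_bPlus, tensorCoaction_tmul_one, TensorProduct.tmul_add]
  abel

variable (k) in
lemma isColinearBialgebra_coaction : IsColinearBialgebra (coaction k) where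
  comul_coaction x := by
    suffices (map (AlgHom.id k (HCon k)) (HCK.comulHom k)).comp (coaction k) =
        (tensorCoaction (coaction k)).comp (HCK.comulHom k) from AlgHom.congr_fun this x
    exact HCK.algHom_ext_bPlus fun x _ => lTensor_comul_coaction_bPlus (rootCoaction_comul x)
  counit_coaction x := by
    suffices (map (AlgHom.id k (HCon k)) (HCK.counitHom k)).comp (coaction k) =
        includeRight.comp (HCK.counitHom k) from AlgHom.congr_fun this x
    refine HCK.algHom_ext fun t => ?_
    obtain ⟨c, rfl⟩ := RTree.mk_surjective t
    simp [coaction_tree, coactTree, HCK.counitHom, map_list_sum, Function.comp_def]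

end RootCoaction

/-! ### The counit of `𝓗` acts as the identity -/

section Counit

lemma RTree.mk_cons_ne_bullet (c r : PForest) : RTree.mk (.cons c r) ≠ RTree.bullet := fun h => by
  have edges_eq : (PForest.cons c r).size = PForest.nil.size := congrArg RTree.edges h
  simp [PForest.size] at edges_eq

lemma HCon.tree_mk_nil : (HCon.tree (RTree.mk .nil) : HCon k) = 1 := dif_pos rfl

lemma HCon.tree_mk_cons (c r : PForest) : (HCon.tree (RTree.mk (.cons c r)) : HCon k) =
    MvPolynomial.X (R := k)
      (⟨_, RTree.mk_cons_ne_bullet c r⟩ : {t : RTree // t ≠ RTree.bullet}) :=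
  dif_neg (RTree.mk_cons_ne_bullet c r)

lemma HCon.counit_tree_mk_cons (c r : PForest) :
    HCon.counit (HCon.tree (RTree.mk (.cons c r)) : HCon k) = 0 := by
  rw [HCon.tree_mk_cons]
  exact MvPolynomial.aeval_X (R := k) _ _

lemma HCon.forest_components_cons_false (m n : MForest) :
    (HCon.forest (MForest.cons false m n).components : HCon k) =
      HCon.forest m.components * HCon.forest n.components := by
  simp only [MForest.components, MForest.rootComponent, MForest.otherComponents, HCon.forest,
    HCon.forest_append]
  ring

lemma HCon.counit_forest_components (m : MForest) :
    HCon.counit (HCon.forest m.components : HCon k) = if m.unmarked then 1 else 0 := by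
  induction m with
  | nil =>
    simp [MForest.components, MForest.rootComponent, MForest.otherComponents, HCon.forest,
      HCon.tree_mk_nil, MForest.unmarked]
  | cons mark m n ihm ihn =>
    cases mark with
    | true =>
      simp [MForest.components, MForest.rootComponent, HCon.forest, HCon.counit_tree_mk_cons,
        MForest.unmarked]
    | false =>
      rw [HCon.forest_components_cons_false, map_mul, ihm, ihn, ite_zero_mul_ite_zero, mul_one]
      simp [MForest.unmarked]

lemma MForest.contract_eq_erase : ∀ {m : MForest}, m.unmarked → m.contract = m.erase
  | .nil, _ => rfl
  | .cons false m n, h => by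
    simp only [MForest.unmarked, Bool.not_false, Bool.true_and, Bool.and_eq_true] at h
    rw [MForest.contract, MForest.erase, contract_eq_erase h.1, contract_eq_erase h.2]

variable (k) in
lemma slice_counit_comp_coaction :
    slice (HCon.counit : HCon k →ₐ[k] k).toLinearMap ∘ₗ (coaction k).toLinearMap =
      LinearMap.id := by
  suffices characterHom (coaction k) HCon.counit = AlgHom.id k (HCK k) from
    congrArg AlgHom.toLinearMap this
  refine HCK.algHom_ext fun t => ?_
  obtain ⟨c, rfl⟩ := RTree.mk_surjective t
  have slice_term : ∀ m ∈ c.markings,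
      slice (HCon.counit : HCon k →ₐ[k] k).toLinearMap
          (HCon.forest m.components ⊗ₜ[k] HCK.tree (RTree.mk m.contract)) =
        (if m.unmarked then (1 : HCK k) else 0) * HCK.tree (RTree.mk c) := fun m hm => by
    rw [slice_tmul, AlgHom.toLinearMap_apply, HCon.counit_forest_components]
    split_ifs with h
    · rw [one_smul, one_mul, MForest.contract_eq_erase h, erase_of_mem_markings c m hm]
    · rw [zero_smul, zero_mul]
  rw [characterHom_apply, coaction_tree, coactTree, map_list_sum, List.map_map]
  refine (congrArg List.sum (List.map_congr_left slice_term)).trans ?_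
  rw [List.sum_map_mul_right, sum_unmarked, one_mul, AlgHom.id_apply]

end Counit

/-! ### Degrees of forests -/

section Degree

/-- The number of edges of a forest. -/
def PForest.edgeCount : PForest → ℕ
  | nil => 0
  | cons c r => c.size + r.edgeCount

lemma PForest.edgeCount_append (c d : PForest) :
    (c.append d).edgeCount = c.edgeCount + d.edgeCount := by
  induction c with
  | nil => simp [append, edgeCount]
  | cons c r _ ih => simp only [append, edgeCount, ih, add_assoc]

lemma MForest.edgeCount_components_add_size_contract (m : MForest) :
    m.components.edgeCount + m.contract.size = m.erase.size := by
  simp only [components, PForest.edgeCount]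
  induction m with
  | nil => rfl
  | cons mark c r ihc ihr =>
    cases mark <;>
    · simp only [rootComponent, otherComponents, contract, erase, PForest.edgeCount, PForest.size,
        PForest.edgeCount_append, HCK.size_append]
      omega

lemma MForest.size_pruning_add_size_trunk (m : MForest) :
    m.pruning.size + m.trunk.size = m.erase.size := by
  induction m with
  | nil => rfl
  | cons mark c r ihc ihr =>
    cases mark <;>
    · simp only [pruning, trunk, erase, PForest.size, HCK.size_append]
      omega

variable (k) in
/-- The grading of the Connes–Kreimer algebra by the number of vertices. -/
def HCK.grading (n : ℕ) : Submodule k (HCK k) :=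
  MvPolynomial.weightedHomogeneousSubmodule k RTree.vertices n

variable (k) in
/-- The grading of `𝓗` by the number of edges. -/
def HCon.grading (n : ℕ) : Submodule k (HCon k) :=
  MvPolynomial.weightedHomogeneousSubmodule k
    (fun t : {t : RTree // t ≠ RTree.bullet} => t.1.edges) n

instance HCK.grading.gradedMonoid : SetLike.GradedMonoid (HCK.grading k) :=
  MvPolynomial.WeightedHomogeneousSubmodule.gradedMonoid (R := k)

instance HCon.grading.gradedMonoid : SetLike.GradedMonoid (HCon.grading k) :=
  MvPolynomial.WeightedHomogeneousSubmodule.gradedMonoid (R := k)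

variable (k) in
lemma HCK.iSup_grading : ⨆ n, HCK.grading k n = ⊤ :=
  letI := MvPolynomial.weightedDecomposition k RTree.vertices
  (DirectSum.Decomposition.isInternal
    (MvPolynomial.weightedHomogeneousSubmodule k RTree.vertices)).submodule_iSup_eq_top

lemma HCK.tree_mem_grading (c : PForest) :
    (HCK.tree (RTree.mk c) : HCK k) ∈ HCK.grading k (c.size + 1) :=
  MvPolynomial.isWeightedHomogeneous_X (R := k) RTree.vertices (RTree.mk c)

lemma HCK.forest_mem_grading (c : PForest) : (HCK.forest c : HCK k) ∈ HCK.grading k c.size := by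
  induction c with
  | nil => exact SetLike.GradedOne.one_mem
  | cons c r _ ih => exact SetLike.mul_mem_graded (HCK.tree_mem_grading c) ih

lemma HCon.tree_mem_grading (c : PForest) :
    (HCon.tree (RTree.mk c) : HCon k) ∈ HCon.grading k c.size := by
  cases c with
  | nil => exact HCon.tree_mk_nil (k := k) ▸ SetLike.GradedOne.one_mem
  | cons c r =>
    rw [HCon.tree_mk_cons]
    exact MvPolynomial.isWeightedHomogeneous_X (R := k) _
      (⟨_, RTree.mk_cons_ne_bullet c r⟩ : {t : RTree // t ≠ RTree.bullet})

lemma HCon.forest_mem_grading (c : PForest) :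
    (HCon.forest c : HCon k) ∈ HCon.grading k c.edgeCount := by
  induction c with
  | nil => exact SetLike.GradedOne.one_mem
  | cons c r _ ih => exact SetLike.mul_mem_graded (HCon.tree_mem_grading c) ih

lemma HCK.map_mem_of_mem_grading {A : Type*} [CommRing A] [Algebra k A] {𝒜 : ℕ → Submodule k A}
    [SetLike.GradedMonoid 𝒜] {g : HCK k →ₐ[k] A}
    (hg : ∀ c : PForest, g (HCK.tree (RTree.mk c)) ∈ 𝒜 (c.size + 1)) {x : HCK k} {n : ℕ}
    (hx : x ∈ HCK.grading k n) : g x ∈ 𝒜 n := by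
  refine map_mem_of_isWeightedHomogeneous (k := k) (g := g) (fun t => ?_) hx
  obtain ⟨c, rfl⟩ := RTree.mk_surjective t
  exact hg c

lemma coaction_mem_tensorGrading {x : HCK k} {n : ℕ} (hx : x ∈ HCK.grading k n) :
    coaction k x ∈ tensorGrading (HCon.grading k) (HCK.grading k) n := by
  refine HCK.map_mem_of_mem_grading (fun c => ?_) hx
  rw [coaction_tree]
  refine list_sum_mem fun z hz => ?_
  obtain ⟨m, hm, rfl⟩ := List.mem_map.1 hz
  rw [← erase_of_mem_markings c m hm, ← m.edgeCount_components_add_size_contract, add_assoc]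
  exact tmul_mem_tensorGrading (HCon.forest_mem_grading _) (HCK.tree_mem_grading _)

lemma comul_mem_tensorGrading {x : HCK k} {n : ℕ} (hx : x ∈ HCK.grading k n) :
    Coalgebra.comul x ∈ tensorGrading (HCK.grading k) (HCK.grading k) n := by
  refine HCK.map_mem_of_mem_grading (g := HCK.comulHom k) (fun c => ?_) hx
  rw [HCK.comulHom_tree]
  have total_cut : (HCK.tree (RTree.mk c) : HCK k) ⊗ₜ[k] (1 : HCK k) ∈
      tensorGrading (HCK.grading k) (HCK.grading k) (c.size + 1 + 0) :=
    tmul_mem_tensorGrading (HCK.tree_mem_grading c) SetLike.GradedOne.one_mem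
  refine add_mem total_cut (list_sum_mem fun z hz => ?_)
  obtain ⟨m, hm, rfl⟩ := List.mem_map.1 hz
  rw [← erase_of_mem_markings c m (List.mem_of_mem_filter hm), ← m.size_pruning_add_size_trunk,
    add_assoc]
  exact tmul_mem_tensorGrading (HCK.forest_mem_grading _) (HCK.tree_mem_grading _)

lemma RTree.edges_ne_zero {t : RTree} (ht : t ≠ RTree.bullet) : t.edges ≠ 0 := by
  obtain ⟨_ | ⟨c, r⟩, rfl⟩ := RTree.mk_surjective t
  · exact absurd rfl ht
  · change c.size + 1 + r.size ≠ 0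
    omega

lemma HCon.exists_algebraMap_eq_of_mem_grading_zero {x : HCon k} (hx : x ∈ HCon.grading k 0) :
    ∃ r : k, algebraMap k (HCon k) r = x :=
  ⟨MvPolynomial.coeff (R := k) 0 x,
    (MvPolynomial.weightedHomogeneousComponent_zero (R := k) x
      fun t => RTree.edges_ne_zero t.2).symm.trans
        (MvPolynomial.IsWeightedHomogeneous.weightedHomogeneousComponent_same (R := k) hx)⟩

end Degree

/-! ### Operators on the Connes–Kreimer Hopf algebra and on its dual -/

section Operators

lemma leftMul_eq_dualMap (a : HCon k →ₗ[k] k) : leftMul a = (transposeL a).dualMap :=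
  LinearMap.ext fun b => congrArg (· ∘ₗ (coaction k).toLinearMap) (mul'_comp_map a b)

lemma isBiderivation_transposeL {a : HCon k →ₗ[k] k} (ha : IsInfinitesimalCharacter a) :
    IsBiderivation (transposeL a) :=
  (isColinearBialgebra_coaction k).isBiderivation_slice (slice_counit_comp_coaction k) ha

lemma isDualBiderivation_leftMul {a : HCon k →ₗ[k] k} (ha : IsInfinitesimalCharacter a) :
    IsDualBiderivation (transposeL a) (leftMul a) :=
  leftMul_eq_dualMap a ▸ (isBiderivation_transposeL ha).isDualBiderivation_dualMap

lemma transposeL_sub_self_mem_iSup_lt (φ : HCon k →ₐ[k] k) {n : ℕ} {x : HCK k}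
    (hx : x ∈ HCK.grading k n) :
    transposeL φ.toLinearMap x - x ∈ ⨆ i < n, HCK.grading k i := by
  have counital : slice HCon.counit.toLinearMap (coaction k x) = x :=
    LinearMap.congr_fun (slice_counit_comp_coaction k) x
  have eq_slice : transposeL φ.toLinearMap x - x =
      slice (φ.toLinearMap - HCon.counit.toLinearMap) (coaction k x) := by
    rw [slice_sub, LinearMap.sub_apply, counital]
    rfl
  rw [eq_slice]
  refine slice_mem_iSup_lt (fun y hy => ?_) (coaction_mem_tensorGrading hx)
  obtain ⟨r, rfl⟩ := HCon.exists_algebraMap_eq_of_mem_grading_zero hy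
  simp

lemma bijective_transposeL (φ : HCon k →ₐ[k] k) :
    Function.Bijective (transposeL φ.toLinearMap) :=
  bijective_of_sub_mem_iSup_lt (HCK.iSup_grading k)
    fun _ _ hx => transposeL_sub_self_mem_iSup_lt φ hx

/-- The automorphism `(φ ⊗ Id) ∘ Φ` of the Connes–Kreimer Hopf algebra attached to a character
`φ`. -/
def transposeEquiv (φ : HCon k →ₐ[k] k) : HCK k ≃ₐc[k] HCK k :=
  BialgEquiv.ofBijective ((isColinearBialgebra_coaction k).characterBialgHom φ)
    (bijective_transposeL φ)

lemma transposeEquiv_apply (φ : HCon k →ₐ[k] k) (x : HCK k) :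
    transposeEquiv φ x = transposeL φ.toLinearMap x := rfl

lemma isDualAutomorphism_leftMul (φ : HCon k →ₐ[k] k) :
    IsDualAutomorphism (transposeL φ.toLinearMap) (leftMul φ.toLinearMap) :=
  leftMul_eq_dualMap φ.toLinearMap ▸ isDualAutomorphism_dualMap (transposeEquiv φ)

end Operators

/-! ### The graded dual -/

section GradedDual

lemma leftMul_mem_gradedDual {a : HCon k →ₗ[k] k} (ha : HCon.MemGradedDual a)
    {b : Module.Dual k (HCK k)} (hb : b ∈ HCK.gradedDual k) : leftMul a b ∈ HCK.gradedDual k := by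
  obtain ⟨M, hM⟩ := ha
  obtain ⟨N, hN⟩ := hb
  refine ⟨M + N, fun n hn x hx => ?_⟩
  rw [leftMul_eq_dualMap]
  exact apply_slice_eq_zero_of_mem_tensorGrading hM hN hn (coaction_mem_tensorGrading hx)

lemma conv_mem_gradedDual {b c : Module.Dual k (HCK k)} (hb : b ∈ HCK.gradedDual k)
    (hc : c ∈ HCK.gradedDual k) : conv b c ∈ HCK.gradedDual k := by
  obtain ⟨M, hM⟩ := hb
  obtain ⟨N, hN⟩ := hc
  refine ⟨M + N, fun n hn x hx => ?_⟩
  rw [conv_apply]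
  exact apply_slice_eq_zero_of_mem_tensorGrading hM hN hn (comul_mem_tensorGrading hx)

lemma PForest.finite_size_lt (n : ℕ) : {c : PForest | c.size < n}.Finite := by
  induction n with
  | zero => simp
  | succ n ih =>
    refine ((Set.finite_singleton nil).union (ih.image2 cons ih)).subset ?_
    rintro (_ | ⟨c, r⟩) hc
    · exact Or.inl rfl
    · have hcr : c.size + 1 + r.size < n + 1 := hc
      have hc : c.size < n := by omega
      have hr : r.size < n := by omega
      exact Or.inr ⟨c, hc, r, hr, rfl⟩

open Classical in
lemma PForest.exists_toFinsupp_eq (s : RTree →₀ ℕ) : ∃ c : PForest,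
    Multiset.toFinsupp (c.toList.map RTree.mk : List RTree) = s := by
  obtain ⟨c, hc⟩ := HCK.exists_forest (k := ℤ) s
  rw [HCK.forest_eq] at hc
  exact ⟨c, MvPolynomial.monomial_left_injective one_ne_zero hc⟩

lemma HCK.finite_weight_lt (n : ℕ) : {s : RTree →₀ ℕ | HCK.weight s < n}.Finite := by
  classical
  refine ((PForest.finite_size_lt n).image fun c =>
    Multiset.toFinsupp (c.toList.map RTree.mk : List RTree)).subset fun s hs => ?_
  obtain ⟨c, rfl⟩ := PForest.exists_toFinsupp_eq s
  exact ⟨c, (HCK.weight_forest c).symm.trans_lt hs, rfl⟩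

variable (k) in
/-- The basis of monomials of the Connes–Kreimer algebra. -/
def HCK.monomialBasis : Module.Basis (RTree →₀ ℕ) k (HCK k) :=
  MvPolynomial.basisMonomials RTree k

lemma HCK.monomialBasis_mem_grading (s : RTree →₀ ℕ) :
    HCK.monomialBasis k s ∈ HCK.grading k (HCK.weight s) := by
  have eq_monomial : HCK.monomialBasis k s = (MvPolynomial.monomial s (1 : k) : MvPolynomial _ k) :=
    congrFun (MvPolynomial.coe_basisMonomials RTree k) s
  rw [eq_monomial]
  exact MvPolynomial.isWeightedHomogeneous_monomial (R := k) _ _ _ rfl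

lemma HCK.monomialBasis_coord_mem_gradedDual (s : RTree →₀ ℕ) :
    (HCK.monomialBasis k).coord s ∈ HCK.gradedDual k := by
  refine ⟨HCK.weight s + 1, fun n hn x hx => ?_⟩
  have weight_ne : HCK.weight s ≠ n := by omega
  exact MvPolynomial.IsWeightedHomogeneous.coeff_eq_zero (R := k) hx s weight_ne

lemma exists_gradedDualPairing_eq {b : Module.Dual k (HCK k)} (hb : b ∈ HCK.gradedDual k) :
    ∃ z, gradedDualPairing k z = dualComul b := by
  obtain ⟨N, hN⟩ := hb
  let S := (HCK.finite_weight_lt N).toFinset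
  have mem_S (s : RTree →₀ ℕ) : s ∈ S ↔ HCK.weight s < N := Set.Finite.mem_toFinset _
  have vanish (s t : RTree →₀ ℕ) (hst : s ∉ S ∨ t ∉ S) :
      dualComul b (HCK.monomialBasis k s ⊗ₜ[k] HCK.monomialBasis k t) = 0 := by
    have weight_le : N ≤ HCK.weight s + HCK.weight t := by grind
    refine (congrArg b (LinearMap.mul'_apply ..)).trans (hN _ weight_le _ ?_)
    exact SetLike.mul_mem_graded (HCK.monomialBasis_mem_grading s)
      (HCK.monomialBasis_mem_grading t)
  let coord (s : RTree →₀ ℕ) : HCK.gradedDual k := ⟨_, HCK.monomialBasis_coord_mem_gradedDual s⟩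
  refine ⟨∑ s ∈ S, ∑ t ∈ S,
    dualComul b (HCK.monomialBasis k s ⊗ₜ[k] HCK.monomialBasis k t) • coord s ⊗ₜ[k] coord t, ?_⟩
  simp only [map_sum, map_smul]
  exact (dual_tensor_eq_sum_of_finite_support (HCK.monomialBasis k) S vanish).symm

lemma gradedDualPairing_restrict_dualMap {T : HCK k →ₗ[k] HCK k}
    (hT : ∀ b ∈ HCK.gradedDual k, T.dualMap b ∈ HCK.gradedDual k)
    (z : HCK.gradedDual k ⊗[k] HCK.gradedDual k) :
    gradedDualPairing k
        ((T.dualMap.restrict hT).rTensor _ z + (T.dualMap.restrict hT).lTensor _ z) =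
      dualTensor T LinearMap.id (gradedDualPairing k z) +
        dualTensor LinearMap.id T (gradedDualPairing k z) := by
  have pairing_rTensor : gradedDualPairing k ∘ₗ (T.dualMap.restrict hT).rTensor _ =
      dualTensor T LinearMap.id ∘ₗ gradedDualPairing k := by
    ext b c x y
    simp [gradedDualPairing, dualTensor]
  have pairing_lTensor : gradedDualPairing k ∘ₗ (T.dualMap.restrict hT).lTensor _ =
      dualTensor LinearMap.id T ∘ₗ gradedDualPairing k := by
    ext b c x y
    simp [gradedDualPairing, dualTensor]
  rw [map_add]
  exact congrArg₂ (· + ·) (LinearMap.congr_fun pairing_rTensor z)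
    (LinearMap.congr_fun pairing_lTensor z)

lemma isGradedDualBiderivation_leftMul {a : HCon k →ₗ[k] k} (ha : IsInfinitesimalCharacter a)
    (ha' : HCon.MemGradedDual a) : IsGradedDualBiderivation (leftMul a) := by
  have biderivation := isDualBiderivation_leftMul ha
  have mem_gradedDual : ∀ b ∈ HCK.gradedDual k, leftMul a b ∈ HCK.gradedDual k :=
    fun _ hb => leftMul_mem_gradedDual ha' hb
  refine ⟨mem_gradedDual,
    fun b hb c hc => ⟨conv_mem_gradedDual hb hc, biderivation.leibniz b c⟩,
    fun b hb => ⟨exists_gradedDualPairing_eq hb, fun z hz => ?_⟩⟩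
  rw [biderivation.coleibniz, ← hz]
  simp only [leftMul_eq_dualMap] at mem_gradedDual ⊢
  exact gradedDualPairing_restrict_dualMap mem_gradedDual z

end GradedDual

end

end ForestHopf

theorem mainTheorem2_general (k : Type*) [CommRing k] :
    (∀ a : HCon k →ₗ[k] k, IsInfinitesimalCharacter a →
      IsBiderivation (transposeL a) ∧
      IsDualBiderivation (transposeL a) (leftMul a) ∧
      (HCon.MemGradedDual a → IsGradedDualBiderivation (leftMul a))) ∧
    (∀ φ : HCon k →ₐ[k] k,
      (∃ e : HCK k ≃ₐc[k] HCK k, (∀ x, e x = transposeL φ.toLinearMap x) ∧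
        ∀ x, e (HopfAlgebra.antipode k x) = HopfAlgebra.antipode k (e x)) ∧
      IsDualAutomorphism (transposeL φ.toLinearMap) (leftMul φ.toLinearMap)) := by
  refine ⟨fun a ha => ⟨?biderivation, ?dualBiderivation, ?gradedDualBiderivation⟩,
    fun φ => ⟨⟨transposeEquiv φ, ?apply, ?antipode⟩, ?dualAutomorphism⟩⟩
  case biderivation => exact isBiderivation_transposeL ha
  case dualBiderivation => exact isDualBiderivation_leftMul ha
  case gradedDualBiderivation => exact isGradedDualBiderivation_leftMul ha
  case apply => exact transposeEquiv_apply φ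
  case antipode => exact bialgHom_antipode (transposeEquiv φ : HCK k →ₐc[k] HCK k)
  case dualAutomorphism => exact isDualAutomorphism_leftMul φ

theorem mainTheorem2 (k : Type*) [Field k] [CharZero k] :
    (∀ a : HCon k →ₗ[k] k, IsInfinitesimalCharacter a →
      IsBiderivation (transposeL a) ∧
      IsDualBiderivation (transposeL a) (leftMul a) ∧
      (HCon.MemGradedDual a → IsGradedDualBiderivation (leftMul a))) ∧
    (∀ φ : HCon k →ₐ[k] k,
      (∃ e : HCK k ≃ₐc[k] HCK k, (∀ x, e x = transposeL φ.toLinearMap x) ∧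
        ∀ x, e (HopfAlgebra.antipode k x) = HopfAlgebra.antipode k (e x)) ∧
      IsDualAutomorphism (transposeL φ.toLinearMap) (leftMul φ.toLinearMap)) :=
  mainTheorem2_general k
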